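/- \textbf{Programs.} A \emph{program} of arity $n$ is a finite tree built by the following clauses: the projections $\pi^n_i$ ($1\le i\le n$), the null functions $Z^n$, the successor $\mathit{Succ}$ (arity 1), $+$, $\times$ and $\chi_\le$ (arity 2, where $\chi_\le(a,b)=1$ if $a\le b$ and $0$ otherwise), the composition $\circ^n_m(h,g_1,\dots,g_m)$ of a program $h$ of arity $m$ with programs $g_1,\dots,g_m$ of arity $n$, and the minimization $\mu^n(g)$ of a program $g$ of arity $n+1$. A program of arity $n$ computes a partial function $\mathbb N^n\rightharpoonup\mathbb N$: a composition is defined when all the $g_i$ are defined and $h$ is defined at their values, and $\mu^n(g)(p_1,\dots,p_n)$ is the least $y$ with $g(p_1,\dots,p_n,y)=0$, provided $g(p_1,\dots,p_n,z)$ is defined for all $z<y$. The program $f$ \emph{terminates} at $p_1,\dots,p_n$ if its function is defined there. \textbf{Representation.} Write $x\le y$ for $\exists z\,(z+x=y)$ and $x<y$ for $S(x)\le y$. To each program $f$ of arity $n$ associate a proposition $A[x_1,\dots,x_n,y]$ of arithmetic: $y=x_i$ for $\pi^n_i$; $y=0$ for $Z^n$; $y=S(x_1)$ for $\mathit{Succ}$;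 $y=x_1+x_2$ for $+$; $y=x_1\times x_2$ for $\times$; $(x_1\le x_2\wedge y=1)\vee(x_2<x_1\wedge y=0)$ for $\chi_\le$; $\exists w_1\cdots\exists w_m\,(B_1[x_1,\dots,x_n,w_1]\wedge\cdots\wedge B_m[x_1,\dots,x_n,w_m]\wedge C[w_1,\dots,w_m,y])$ for $\circ^n_m(h,g_1,\dots,g_m)$, where $B_1,\dots,B_m,C$ represent $g_1,\dots,g_m,h$; and $\forall z\,(z<y\Rightarrow\exists w\,B[x_1,\dots,x_n,z,S(w)])\wedge B[x_1,\dots,x_n,y,0]$ for $\mu^n(g)$, where $B$ represents $g$. For $p\in\mathbb N$ let $\underline p$ be the term $S^p(0)$. \textbf{Theories.} Let $\mathcal T$ be a theory in classical first-order logic with equality, in a language with finitely many symbols that contains $0,S,+,\times$. Number terms, propositions and programs as finite labelled trees, $\ulcorner l(t_1,\dots,t_k)\urcorner=\ulcorner l\urcorner;(\ulcorner t_1\urcorner;(\cdots;(\ulcorner t_k\urcorner;0)))$, where $;$ is a fixed computable bijection $\mathbb N^2\to\mathbb N\setminus\{0\}$ and the labels have fixed numbers except that the function symbols, and the predicate symbols,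 of the language may be numbered in any injective way. Assume that \begin{itemize} \item the set of axioms of $\mathcal T$ is decidable; \item $\mathcal T$ is an extension of Robinson's arithmetic: it proves each of the axioms $\forall x\,(S(x)\neq 0)$, $\forall x\forall y\,(S(x)=S(y)\Rightarrow x=y)$, $\forall x\,(x\ne 0\Rightarrow\exists y\,(x=S(y)))$, $\forall x\,(x+0=x)$, $\forall x\forall y\,(x+S(y)=S(x+y))$, $\forall x\,(x\times 0=0)$, $\forall x\forall y\,(x\times S(y)=x\times y+x)$; \item $\mathcal T$ has a standard model: a model with domain $\mathbb N$ in which $0,S,+,\times,=$ have their usual meaning (any other symbols being interpreted in some way). \end{itemize} \textbf{Theorem.} \begin{enumerate} \item For every $n$, every program $f$ of arity $n$, represented by the proposition $A$, and all $p_1,\dots,p_n\in\mathbb N$, the closed proposition $\exists y\,A[\underline{p_1},\dots,\underline{p_n},y]$ is provable in $\mathcal T$ if and only if $f$ terminates at $p_1,\dots,p_n$. \item The halting problem reduces to provability in $\mathcal T$: there is a total computable function $F:\mathbb N\to\mathbb N$ that maps the number of each $(f,p_1,\dots,p_n)$ to $\ulcorner\exists y\,A[\underline{p_1},\dots,\underline{p_n},y]\urcorner$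 and such that, for every $k\in\mathbb N$, $k$ is the number of some $(f,p_1,\dots,p_n)$ such that $f$ terminates at $p_1,\dots,p_n$ if and only if $F(k)$ is the number of a closed proposition provable in $\mathcal T$. \item Provability in $\mathcal T$ is undecidable: the set of numbers of closed propositions provable in $\mathcal T$ is not computable. \end{enumerate} -/

import Mathlib

universe u v

namespace Arithmetic

open FirstOrder FirstOrder.Language

/-! ### Languages containing arithmetic -/

/-- The function symbols `0`, `S`, `+`, `×`. -/
inductive Func : ℕ → Type
  | zero : Func 0
  | succ : Func 1
  | add : Func 2
  | mul : Func 2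

/-- The first-order language of arithmetic: `0`, `S`, `+`, `×` (equality is a logical symbol). -/
def arith : FirstOrder.Language := ⟨Func, fun _ => Empty⟩

/-- A language containing the symbols of arithmetic, with the additional symbols of `L'`. -/
abbrev LA (L' : FirstOrder.Language.{u, v}) : FirstOrder.Language.{u, v} := arith.sum L'

/-- Terms over `L` whose variables are among `&0, …, &(n - 1)`. -/
abbrev Tm (L : FirstOrder.Language.{u, v}) (n : ℕ) : Type u := L.Term (Empty ⊕ Fin n)

/-- Propositions over `L` whose free variables are among `&0, …, &(n - 1)`.
The quantifier of `A.all`, for `A : Fm L (n + 1)`, binds the last variable `&n` of `A`. -/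
abbrev Fm (L : FirstOrder.Language.{u, v}) (n : ℕ) : Type max u v := L.BoundedFormula Empty n

section Deduction

variable {L : FirstOrder.Language.{u, v}}

/-- The variable `&i`. -/
def bv {n : ℕ} (i : Fin n) : Tm L n := Term.var (Sum.inr i)

/-- Simultaneous substitution of terms for variables, in a term. -/
def substT {m n : ℕ} (σ : Fin m → Tm L n) (t : Tm L m) : Tm L n :=
  t.subst (Sum.elim Empty.elim σ)

/-- A term, seen as a term in one more variable. -/
def wkT {n : ℕ} (t : Tm L n) : Tm L (n + 1) := substT (fun i => bv i.castSucc) t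

/-- A term, seen as a term in `m` more variables. -/
def wkTN {n : ℕ} (m : ℕ) (t : Tm L n) : Tm L (n + m) := substT (fun i => bv (i.castAdd m)) t

/-- The extension of a substitution under a quantifier: the bound variable stays itself. -/
def liftS {m n : ℕ} (σ : Fin m → Tm L n) : Fin (m + 1) → Tm L (n + 1) :=
  Fin.snoc (fun i => wkT (σ i)) (bv (Fin.last n))

/-- Simultaneous capture-avoiding substitution of terms for the free variables. -/
def substF : {m : ℕ} → Fm L m → {n : ℕ} → (Fin m → Tm L n) → Fm L n
  | _, .falsum, _, _ => .falsum
  | _, .equal t u, _, σ => .equal (substT σ t) (substT σ u)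
  | _, .rel R ts, _, σ => .rel R fun i => substT σ (ts i)
  | _, .imp A B, _, σ => .imp (substF A σ) (substF B σ)
  | _, .all A, _, σ => .all (substF A (liftS σ))

/-- A proposition, seen as a proposition in one more variable. -/
def wkF {n : ℕ} (A : Fm L n) : Fm L (n + 1) := substF A fun i => bv i.castSucc

/-- `A[t]`: substitution of `t` for the last variable `&n` of `A`. -/
def inst {n : ℕ} (A : Fm L (n + 1)) (t : Tm L n) : Fm L n := substF A (Fin.snoc bv t)

/-! ### Provability -/

/-- Natural deduction for classical first-order logic with equality. `Deriv Γ A`: the proposition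
`A` has a derivation from hypotheses in `Γ`. The weakening `wkF` in the introduction rule of `∀`
expresses that the quantified variable is not free in the hypotheses. The other connectives and
`∃` are the usual classical abbreviations in terms of `⊥`, `⟹` and `∀`. -/
inductive Deriv : {n : ℕ} → Set (Fm L n) → Fm L n → Prop
  | ax {n : ℕ} {Γ : Set (Fm L n)} {A : Fm L n} (h : A ∈ Γ) : Deriv Γ A
  | impI {n : ℕ} {Γ : Set (Fm L n)} {A B : Fm L n} (h : Deriv (insert A Γ) B) :
      Deriv Γ (A.imp B)
  | impE {n : ℕ} {Γ : Set (Fm L n)} {A B : Fm L n} (h₁ : Deriv Γ (A.imp B)) (h₂ : Deriv Γ A) :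
      Deriv Γ B
  | contra {n : ℕ} {Γ : Set (Fm L n)} {A : Fm L n}
      (h : Deriv (insert A.not Γ) BoundedFormula.falsum) : Deriv Γ A
  | allI {n : ℕ} {Γ : Set (Fm L n)} {A : Fm L (n + 1)} (h : Deriv (wkF '' Γ) A) :
      Deriv Γ A.all
  | allE {n : ℕ} {Γ : Set (Fm L n)} {A : Fm L (n + 1)} (h : Deriv Γ A.all) (t : Tm L n) :
      Deriv Γ (inst A t)
  | eqI {n : ℕ} {Γ : Set (Fm L n)} (t : Tm L n) : Deriv Γ (BoundedFormula.equal t t)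
  | eqE {n : ℕ} {Γ : Set (Fm L n)} {s t : Tm L n} (A : Fm L (n + 1))
      (h₁ : Deriv Γ (BoundedFormula.equal s t)) (h₂ : Deriv Γ (inst A s)) : Deriv Γ (inst A t)

/-- The closed proposition `φ` is provable in the theory `T`. -/
def Provable (T : L.Theory) (φ : L.Sentence) : Prop := Deriv (n := 0) T φ

end Deduction

/-! ### Robinson's arithmetic and standard models -/

section Robinson

variable {L' : FirstOrder.Language.{u, v}} {n : ℕ}

/-- The term `0`. -/
def tZero : Tm (LA L') n := Term.func (l := 0) (Sum.inl Func.zero) ![]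

/-- The term `S(t)`. -/
def tSucc (t : Tm (LA L') n) : Tm (LA L') n := Term.func (l := 1) (Sum.inl Func.succ) ![t]

/-- The term `s + t`. -/
def tAdd (s t : Tm (LA L') n) : Tm (LA L') n := Term.func (l := 2) (Sum.inl Func.add) ![s, t]

/-- The term `s × t`. -/
def tMul (s t : Tm (LA L') n) : Tm (LA L') n := Term.func (l := 2) (Sum.inl Func.mul) ![s, t]

/-- The proposition `s = t`. -/
def fEq (s t : Tm (LA L') n) : Fm (LA L') n := BoundedFormula.equal s t

/-- The numeral of a natural number `p`, that is `S(… S(0) …)` with `p` symbols `S`. -/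
def numeral : ℕ → Tm (LA L') n
  | 0 => tZero
  | p + 1 => tSucc (numeral p)

/-- `s ≤ t`, that is `∃ z (z + s = t)`. -/
def fLe (s t : Tm (LA L') n) : Fm (LA L') n :=
  BoundedFormula.ex (fEq (tAdd (bv (Fin.last n)) (wkT s)) (wkT t))

/-- `s < t`, that is `S(s) ≤ t`. -/
def fLt (s t : Tm (LA L') n) : Fm (LA L') n := fLe (tSucc s) t

variable (L') in
/-- The axioms of Robinson's arithmetic (over logic with equality):
`S(x) ≠ 0`; `S(x) = S(y) ⟹ x = y`; `x ≠ 0 ⟹ ∃ y (x = S(y))`; `x + 0 = x`;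
`x + S(y) = S(x + y)`; `x × 0 = 0`; `x × S(y) = x × y + x`. -/
def robinson : (LA L').Theory :=
  { ∀' ∼(fEq (tSucc (bv 0)) tZero),
    ∀' ∀' (fEq (tSucc (bv 0)) (tSucc (bv 1)) ⟹ fEq (bv 0) (bv 1)),
    ∀' (∼(fEq (bv 0) tZero) ⟹ ∃' fEq (bv 0) (tSucc (bv 1))),
    ∀' fEq (tAdd (bv 0) tZero) (bv 0),
    ∀' ∀' fEq (tAdd (bv 0) (tSucc (bv 1))) (tSucc (tAdd (bv 0) (bv 1))),
    ∀' fEq (tMul (bv 0) tZero) tZero,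
    ∀' ∀' fEq (tMul (bv 0) (tSucc (bv 1))) (tAdd (tMul (bv 0) (bv 1)) (bv 0)) }

/-- `T` is an extension of Robinson's arithmetic: its language contains that of arithmetic, and
every axiom of Robinson's arithmetic is provable in `T`. -/
def ExtendsRobinson (T : (LA L').Theory) : Prop := ∀ φ ∈ robinson L', Provable T φ

/-- The natural numbers with the usual zero, successor, addition and multiplication. -/
instance natStructure : arith.Structure ℕ where
  funMap
    | Func.zero, _ => 0
    | Func.succ, v => v 0 + 1
    | Func.add, v => v 0 + v 1
    | Func.mul, v => v 0 * v 1
  RelMap r _ := r.elim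

/-- `T` has a standard model: a model with domain `ℕ` in which `0`, `S`, `+`, `×` have their usual
meaning (and equality is equality), the additional symbols being interpreted in some way. -/
def HasStandardModel (T : (LA L').Theory) : Prop := ∃ _ : L'.Structure ℕ, ℕ ⊨ T

end Robinson

/-! ### Programs -/

/-- Programs, that is constructions of partial computable functions of `n` arguments: projections,
null functions, successor, addition, multiplication, the characteristic function of `≤`,
composition, and minimization. -/
inductive Prog : ℕ → Type
  | proj {n : ℕ} (i : Fin n) : Prog n
  | zero (n : ℕ) : Prog n
  | succ : Prog 1
  | add : Prog 2
  | mul : Prog 2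
  | leq : Prog 2
  | comp {n m : ℕ} (h : Prog m) (g : Fin m → Prog n) : Prog n
  | mu {n : ℕ} (g : Prog (n + 1)) : Prog n

/-- The partial function computed by a program. A composition is defined when all the `g i` are
defined, and so is `h` at their values. The value of `mu g` at `x` is the least `y` such that
`g (x, y) = 0`, provided that `g (x, z)` is defined for all `z < y`. -/
def Prog.eval : {n : ℕ} → Prog n → (Fin n → ℕ) → Part ℕ
  | _, .proj i => fun x => Part.some (x i)
  | _, .zero _ => fun _ => Part.some 0
  | _, .succ => fun x => Part.some (x 0 + 1)
  | _, .add => fun x => Part.some (x 0 + x 1)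
  | _, .mul => fun x => Part.some (x 0 * x 1)
  | _, .leq => fun x => Part.some (if x 0 ≤ x 1 then 1 else 0)
  | _, .comp h g => fun x =>
      Part.bind ⟨∀ i, ((g i).eval x).Dom, fun d i => ((g i).eval x).get (d i)⟩ h.eval
  | _, .mu g => fun x => Nat.rfind fun y => (g.eval (Fin.snoc x y)).map fun w => decide (w = 0)

/-- The program `f` terminates at `p`. -/
def Prog.Terminates {n : ℕ} (f : Prog n) (p : Fin n → ℕ) : Prop := (f.eval p).Dom

section Represent

variable {L' : FirstOrder.Language.{u, v}}

/-- `∃ w₁ … ∃ wₘ A`, where `A` has the additional variables `w₁, …, wₘ`. -/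
def exN {L : FirstOrder.Language.{u, v}} {k : ℕ} : (m : ℕ) → Fm L (k + m) → Fm L k
  | 0, A => A
  | m + 1, A => exN m (BoundedFormula.ex (n := k + m) A)

/-- `B₁ ∧ (… ∧ (Bₘ ∧ C))`. -/
def conjN {L : FirstOrder.Language.{u, v}} {k m : ℕ} (B : Fin m → Fm L k) (C : Fm L k) : Fm L k :=
  (List.ofFn B).foldr (· ⊓ ·) C

/-- The proposition `A[t₁, …, tₙ, u]`, where `A[x₁, …, xₙ, y]` is the proposition representing the
program `f`:
* `y = xᵢ` for a projection, `y = 0` for a null function, `y = S(x₁)` for the successor,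
  `y = x₁ + x₂` for addition, `y = x₁ × x₂` for multiplication;
* `(x₁ ≤ x₂ ∧ y = 1) ∨ (x₂ < x₁ ∧ y = 0)` for the characteristic function of `≤`;
* `∃ w₁ … ∃ wₘ (B₁[x₁, …, xₙ, w₁] ∧ … ∧ Bₘ[x₁, …, xₙ, wₘ] ∧ C[w₁, …, wₘ, y])` for a composition,
  where `B₁, …, Bₘ, C` represent `g₁, …, gₘ, h`;
* `∀ z (z < y ⟹ ∃ w B[x₁, …, xₙ, z, S(w)]) ∧ B[x₁, …, xₙ, y, 0]` for a minimization, where `B`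
  represents `g`. -/
def Prog.repr : {n : ℕ} → Prog n → {k : ℕ} → (Fin n → Tm (LA L') k) → Tm (LA L') k → Fm (LA L') k
  | _, .proj i, _, t, y => fEq y (t i)
  | _, .zero _, _, _, y => fEq y tZero
  | _, .succ, _, t, y => fEq y (tSucc (t 0))
  | _, .add, _, t, y => fEq y (tAdd (t 0) (t 1))
  | _, .mul, _, t, y => fEq y (tMul (t 0) (t 1))
  | _, .leq, _, t, y =>
      (fLe (t 0) (t 1) ⊓ fEq y (tSucc tZero)) ⊔ (fLt (t 1) (t 0) ⊓ fEq y tZero)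
  | _, .comp (m := m) h g, k, t, y =>
      exN m (conjN
        (fun i => (g i).repr (fun j => wkTN m (t j)) (bv (Fin.natAdd k i)))
        (h.repr (fun i => bv (Fin.natAdd k i)) (wkTN m y)))
  | _, .mu g, k, t, y =>
      BoundedFormula.all
        (fLt (bv (Fin.last k)) (wkT y) ⟹
          BoundedFormula.ex
            (g.repr (Fin.snoc (fun j => wkT (wkT (t j))) (bv (Fin.last k).castSucc))
              (tSucc (bv (Fin.last (k + 1)))))) ⊓
      g.repr (Fin.snoc t y) tZero

variable (L') in
/-- The closed proposition `∃ y A[p₁, …, pₙ, y]`, where `A` represents the program `f` and the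
natural numbers `pᵢ` stand for their numerals. -/
def Prog.haltSentence {n : ℕ} (f : Prog n) (p : Fin n → ℕ) : (LA L').Sentence :=
  BoundedFormula.ex (n := 0) (f.repr (fun i => numeral (p i)) (bv 0))

end Represent

/-! ### Numbering -/

/-- The number of a finite tree with root labelled `l` and immediate subtrees numbered by `ts`,
that is `l ; (t₁ ; (… ; (tₚ ; 0)))`, where `a ; b` is `Nat.pair a b + 1`. -/
def tree (l : ℕ) (ts : List ℕ) : ℕ := Encodable.encode (l :: ts)

/-- A numbering of the symbols of a language. -/
structure SymbolNumbering (L : FirstOrder.Language.{u, v}) where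
  func : (Σ n, L.Functions n) → ℕ
  rel : (Σ n, L.Relations n) → ℕ
  func_injective : Function.Injective func
  rel_injective : Function.Injective rel

/-- The number of a term. -/
def SymbolNumbering.termCode {L : FirstOrder.Language.{u, v}} (num : SymbolNumbering L) {n : ℕ} :
    Tm L n → ℕ
  | .var (Sum.inl e) => e.elim
  | .var (Sum.inr i) => tree 0 [(i : ℕ)]
  | .func f ts => tree (num.func ⟨_, f⟩ + 1) (List.ofFn fun i => num.termCode (ts i))

/-- The number of a proposition. -/
def SymbolNumbering.code {L : FirstOrder.Language.{u, v}} (num : SymbolNumbering L) :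
    {n : ℕ} → Fm L n → ℕ
  | _, .falsum => tree 0 []
  | _, .equal s t => tree 1 [num.termCode s, num.termCode t]
  | _, .imp A B => tree 2 [num.code A, num.code B]
  | _, .all A => tree 3 [num.code A]
  | _, .rel R ts => tree (num.rel ⟨_, R⟩ + 4) (List.ofFn fun i => num.termCode (ts i))

/-- The number of a program. -/
def Prog.code : {n : ℕ} → Prog n → ℕ
  | n, .proj i => tree 0 [n, (i : ℕ)]
  | n, .zero _ => tree 1 [n]
  | _, .succ => tree 2 []
  | _, .add => tree 3 []
  | _, .mul => tree 4 []
  | _, .leq => tree 5 []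
  | n, .comp h g => tree 6 (n :: h.code :: List.ofFn fun i => (g i).code)
  | n, .mu g => tree 7 [n, g.code]

/-- The number of an instance `f, p₁, …, pₙ` of the halting problem. -/
def Prog.instanceCode {n : ℕ} (f : Prog n) (p : Fin n → ℕ) : ℕ := tree f.code (List.ofFn p)

/-- The halting problem: `k` is the number of some `f, p₁, …, pₙ` such that the program `f`
terminates at `p₁, …, pₙ`. -/
def Halting (k : ℕ) : Prop :=
  ∃ (n : ℕ) (f : Prog n) (p : Fin n → ℕ), f.instanceCode p = k ∧ f.Terminates p

/-- The set of axioms of `T` is decidable. -/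
def DecidableAxioms {L : FirstOrder.Language.{u, v}} (num : SymbolNumbering L) (T : L.Theory) : Prop :=
  ComputablePred fun k : ℕ => ∃ φ ∈ T, num.code φ = k

/-- Provability in `T`, as a predicate on numbers of closed propositions. -/
def ProvableCode {L : FirstOrder.Language.{u, v}} (num : SymbolNumbering L) (T : L.Theory) (k : ℕ) : Prop :=
  ∃ φ : L.Sentence, num.code φ = k ∧ Provable T φ

end Arithmetic

/-! A program is matched with its representing proposition once inside the theory and once in the
standard model. If `f` returns `q` at `p`, Robinson's arithmetic derives `A[p, q]` for the numerals,
by induction on `f` (`ProvesRobinson.repr`). Only minimization is delicate. There a claim about all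
`z < y` is needed when `y` is a numeral, and it holds because the theory proves that anything below
the numeral of `q` is one of the numerals of `0, …, q - 1` (`lt_numeral_cases`). Conversely, a
provable proposition is true in the standard model (`Deriv.sound`), where `A` defines exactly the
graph of `f` (`realize_repr`), so a provable halting sentence has a genuine output as witness.
Together these give `provable_haltSentence_iff`.

For the reduction, `A` is computed on numbers by course-of-values recursion on the number of the
program (`reprCode`, `code_repr`). Another such recursion, `arity`, recognizes the numbers of
programs; inputs that number no instance are sent to `⊥`, which the standard model makes unprovable.
Since the numbering is injective (`code_injective`), a provable number is the number of the intended
proposition and of no other.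

Undecidability then needs one program with undecidable halting (`exists_undecidable_prog`). Programs
compute all primitive recursive functions, recursion being replaced by a search for a code of the
computation under Gödel's beta function (`ByProg.prec`). Minimizing over the bound of a primitive
recursive bounded universal evaluator gives the program. -/

namespace Arithmetic

open FirstOrder FirstOrder.Language

/-! ### Calculus of simultaneous substitutions -/

section Substitution

variable {L : FirstOrder.Language.{u, v}}

@[simp]
theorem substT_bv_apply {m n : ℕ} (σ : Fin m → Tm L n) (i : Fin m) : substT σ (bv i) = σ i := rfl

@[simp]
theorem substT_func {m n l : ℕ} (σ : Fin m → Tm L n) (f : L.Functions l) (ts : Fin l → Tm L m) :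
    substT σ (Term.func f ts) = Term.func f fun i => substT σ (ts i) := rfl

@[elab_as_elim]
theorem Tm.ind {n : ℕ} {P : Tm L n → Prop} (hv : ∀ i, P (bv i))
    (hf : ∀ (l : ℕ) (f : L.Functions l) (ts : Fin l → Tm L n), (∀ i, P (ts i)) → P (Term.func f ts))
    (t : Tm L n) : P t := by
  induction t with
  | var x =>
    rcases x with e | i
    · exact e.elim
    · exact hv i
  | func f ts ih => exact hf _ f ts ih

theorem substT_substT {m n k : ℕ} (σ : Fin m → Tm L n) (τ : Fin n → Tm L k) (t : Tm L m) :
    substT τ (substT σ t) = substT (fun i => substT τ (σ i)) t := by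
  induction t using Tm.ind with
  | hv i => rfl
  | hf l f ts ih => simp [ih]

@[simp]
theorem substT_bv {n : ℕ} (t : Tm L n) : substT bv t = t := by
  induction t using Tm.ind with
  | hv i => rfl
  | hf l f ts ih => simp [ih]

@[simp]
theorem wkT_bv {n : ℕ} (i : Fin n) : wkT (bv i : Tm L n) = bv i.castSucc := rfl

@[simp]
theorem liftS_castSucc {m n : ℕ} (σ : Fin m → Tm L n) (i : Fin m) :
    liftS σ i.castSucc = wkT (σ i) := by
  simp [liftS]

@[simp]
theorem liftS_last {m n : ℕ} (σ : Fin m → Tm L n) : liftS σ (Fin.last m) = bv (Fin.last n) := by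
  simp [liftS]

@[simp]
theorem substT_liftS_wkT {m n : ℕ} (σ : Fin m → Tm L n) (t : Tm L m) :
    substT (liftS σ) (wkT t) = wkT (substT σ t) := by
  simp [wkT, substT_substT]

@[simp]
theorem substT_snoc_wkT {m n : ℕ} (σ : Fin m → Tm L n) (s : Tm L n) (t : Tm L m) :
    substT (Fin.snoc σ s : Fin (m + 1) → Tm L n) (wkT t) = substT σ t := by
  simp [wkT, substT_substT]

theorem liftS_bv {n : ℕ} : liftS (bv : Fin n → Tm L n) = bv := by
  funext i
  refine Fin.lastCases ?_ (fun i => ?_) i <;> simp [wkT]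

theorem substT_liftS_comp {m n k : ℕ} (σ : Fin m → Tm L n) (τ : Fin n → Tm L k) :
    (fun i => substT (liftS τ) (liftS σ i)) = liftS fun i => substT τ (σ i) := by
  funext i
  refine Fin.lastCases ?_ (fun i => ?_) i <;> simp

theorem substT_snoc_liftS {m n k : ℕ} (σ : Fin m → Tm L n) (τ : Fin n → Tm L k) (s : Tm L k) :
    (fun i => substT (Fin.snoc τ s : Fin (n + 1) → Tm L k) (liftS σ i)) =
      Fin.snoc (fun i => substT τ (σ i)) s := by
  funext i
  refine Fin.lastCases ?_ (fun i => ?_) i <;> simp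

theorem substF_substF {m : ℕ} (A : Fm L m) {n k : ℕ} (σ : Fin m → Tm L n) (τ : Fin n → Tm L k) :
    substF (substF A σ) τ = substF A fun i => substT τ (σ i) := by
  induction A generalizing n k with
  | falsum => rfl
  | equal t u => simp [substF, substT_substT]
  | rel R ts => simp [substF, substT_substT]
  | imp A B ihA ihB => simp [substF, ihA, ihB]
  | all A ih => simp [substF, ih, substT_liftS_comp]

@[simp]
theorem substF_bv {n : ℕ} (A : Fm L n) : substF A bv = A := by
  induction A with
  | falsum => rfl
  | equal t u => simp [substF]
  | rel R ts => simp [substF]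
  | imp A B ihA ihB => simp [substF, ihA, ihB]
  | all A ih => simp [substF, ih, liftS_bv]

theorem substF_wkF {m n : ℕ} (A : Fm L m) (σ : Fin (m + 1) → Tm L n) :
    substF (wkF A) σ = substF A fun i => σ i.castSucc := by
  simp [wkF, substF_substF]

theorem wkF_substF {m n : ℕ} (A : Fm L m) (σ : Fin m → Tm L n) :
    wkF (substF A σ) = substF (wkF A) (liftS σ) := by
  rw [substF_wkF, wkF, substF_substF]
  simp [wkT]

theorem substF_inst {m n : ℕ} (A : Fm L (m + 1)) (t : Tm L m) (σ : Fin m → Tm L n) :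
    substF (inst A t) σ = inst (substF A (liftS σ)) (substT σ t) := by
  simp only [inst, substF_substF]
  rw [substT_snoc_liftS]
  congr 1
  funext i
  refine Fin.lastCases ?_ (fun i => ?_) i <;> simp

/-- The weakening built into `liftS` is undone by the instantiation, so an instance of a quantified
substituted formula is a single substitution. -/
theorem inst_substF_liftS {m n : ℕ} (A : Fm L (m + 1)) (σ : Fin m → Tm L n) (t : Tm L n) :
    inst (substF A (liftS σ)) t = substF A (Fin.snoc σ t) := by
  simp only [inst, substF_substF]
  rw [substT_snoc_liftS]
  simp

/-- The extension of a substitution under `l` quantifiers. -/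
def liftSN {m n : ℕ} (σ : Fin m → Tm L n) : (l : ℕ) → Fin (m + l) → Tm L (n + l)
  | 0 => σ
  | l + 1 => liftS (liftSN σ l)

theorem wkT_wkTN {n : ℕ} (l : ℕ) (t : Tm L n) : wkT (wkTN l t) = wkTN (l + 1) t := by
  simp only [wkT, wkTN, substT_substT]
  rfl

theorem liftSN_castAdd {m n : ℕ} (σ : Fin m → Tm L n) (l : ℕ) (i : Fin m) :
    liftSN σ l (i.castAdd l) = wkTN l (σ i) := by
  induction l with
  | zero => exact (substT_bv _).symm
  | succ l ih => rw [← wkT_wkTN, ← ih]; exact liftS_castSucc (liftSN σ l) (i.castAdd l)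

theorem liftSN_natAdd {m n : ℕ} (σ : Fin m → Tm L n) (l : ℕ) (i : Fin l) :
    liftSN σ l (Fin.natAdd m i) = bv (Fin.natAdd n i) := by
  induction l with
  | zero => exact i.elim0
  | succ l ih =>
    refine Fin.lastCases ?_ (fun i => ?_) i
    · exact liftS_last _
    · have := liftS_castSucc (liftSN σ l) (Fin.natAdd m i)
      rw [ih] at this
      exact this

theorem substT_liftSN_wkTN {m n : ℕ} (σ : Fin m → Tm L n) (l : ℕ) (t : Tm L m) :
    substT (liftSN σ l) (wkTN l t) = wkTN l (substT σ t) := by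
  conv_lhs => rw [wkTN, substT_substT]
  conv_rhs => rw [wkTN, substT_substT]
  simp [liftSN_castAdd, wkTN]

theorem substF_exN {m n : ℕ} (l : ℕ) (A : Fm L (m + l)) (σ : Fin m → Tm L n) :
    substF (exN l A) σ = exN l (substF A (liftSN σ l)) := by
  induction l with
  | zero => rfl
  | succ l ih => exact ih _

theorem substF_inf {m n : ℕ} (A B : Fm L m) (σ : Fin m → Tm L n) :
    substF (A ⊓ B) σ = substF A σ ⊓ substF B σ := rfl

theorem substF_sup {m n : ℕ} (A B : Fm L m) (σ : Fin m → Tm L n) :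
    substF (A ⊔ B) σ = substF A σ ⊔ substF B σ := rfl

theorem substF_ex {m n : ℕ} (A : Fm L (m + 1)) (σ : Fin m → Tm L n) :
    substF A.ex σ = (substF A (liftS σ)).ex := rfl

theorem substF_conjN {m n l : ℕ} (B : Fin l → Fm L m) (C : Fm L m) (σ : Fin m → Tm L n) :
    substF (conjN B C) σ = conjN (fun i => substF (B i) σ) (substF C σ) := by
  unfold conjN
  have h : List.ofFn (fun i => substF (B i) σ) = (List.ofFn B).map (substF · σ) := by
    simp [List.map_ofFn, Function.comp_def]
  rw [h]
  induction List.ofFn B with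
  | nil => rfl
  | cons a l ih => simp [substF_inf, ih]

end Substitution

section SubstitutionArith

variable {L' : FirstOrder.Language.{u, v}} {m n : ℕ}

@[simp]
theorem substT_tZero (σ : Fin m → Tm (LA L') n) : substT σ tZero = tZero := by
  refine congrArg (Term.func (L := LA L') (l := 0) (Sum.inl Func.zero)) ?_
  exact Subsingleton.elim (α := Fin 0 → Tm (LA L') n) _ _

@[simp]
theorem substT_tSucc (σ : Fin m → Tm (LA L') n) (t : Tm (LA L') m) :
    substT σ (tSucc t) = tSucc (substT σ t) := by
  refine congrArg (Term.func (L := LA L') (l := 1) (Sum.inl Func.succ)) ?_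
  funext i
  fin_cases i
  rfl

@[simp]
theorem substT_tAdd (σ : Fin m → Tm (LA L') n) (s t : Tm (LA L') m) :
    substT σ (tAdd s t) = tAdd (substT σ s) (substT σ t) := by
  refine congrArg (Term.func (L := LA L') (l := 2) (Sum.inl Func.add)) ?_
  funext i
  fin_cases i <;> rfl

@[simp]
theorem substT_tMul (σ : Fin m → Tm (LA L') n) (s t : Tm (LA L') m) :
    substT σ (tMul s t) = tMul (substT σ s) (substT σ t) := by
  refine congrArg (Term.func (L := LA L') (l := 2) (Sum.inl Func.mul)) ?_
  funext i
  fin_cases i <;> rfl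

@[simp]
theorem substT_numeral (σ : Fin m → Tm (LA L') n) (p : ℕ) :
    substT σ (numeral p) = numeral p := by
  induction p with
  | zero => exact substT_tZero σ
  | succ p ih => simp [numeral, ih]

@[simp]
theorem wkT_tZero : wkT (tZero : Tm (LA L') n) = tZero := substT_tZero _

@[simp]
theorem wkT_tSucc (t : Tm (LA L') n) : wkT (tSucc t) = tSucc (wkT t) := substT_tSucc _ _

@[simp]
theorem wkT_numeral (p : ℕ) : wkT (numeral p : Tm (LA L') n) = numeral p := substT_numeral _ _

@[simp]
theorem wkTN_numeral (l p : ℕ) : wkTN l (numeral p : Tm (LA L') n) = numeral p :=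
  substT_numeral _ _

theorem substF_fEq (σ : Fin m → Tm (LA L') n) (s t : Tm (LA L') m) :
    substF (fEq s t) σ = fEq (substT σ s) (substT σ t) := rfl

theorem substF_fLe (σ : Fin m → Tm (LA L') n) (s t : Tm (LA L') m) :
    substF (fLe s t) σ = fLe (substT σ s) (substT σ t) := by
  simp [fLe, substF_ex, substF_fEq]

theorem substF_fLt (σ : Fin m → Tm (LA L') n) (s t : Tm (LA L') m) :
    substF (fLt s t) σ = fLt (substT σ s) (substT σ t) := by
  simp [fLt, substF_fLe]

/-- A representing proposition depends on its context only through the terms handed to it. Hence the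
quantifier and equality rules can be applied to `f.repr` without unfolding it. -/
theorem substF_repr {a : ℕ} (f : Prog a) {m n : ℕ} (t : Fin a → Tm (LA L') m) (y : Tm (LA L') m)
    (σ : Fin m → Tm (LA L') n) :
    substF (f.repr t y) σ = f.repr (fun i => substT σ (t i)) (substT σ y) := by
  induction f generalizing m n with
  | proj i => simp [Prog.repr, substF_fEq]
  | zero k => simp [Prog.repr, substF_fEq]
  | succ => simp [Prog.repr, substF_fEq]
  | add => simp [Prog.repr, substF_fEq]
  | mul => simp [Prog.repr, substF_fEq]
  | leq => simp [Prog.repr, substF_sup, substF_inf, substF_fEq, substF_fLe, substF_fLt]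
  | comp h g ihh ihg =>
    simp [Prog.repr, substF_exN, substF_conjN, ihh, ihg, substT_liftSN_wkTN, liftSN_natAdd]
  | mu g ih =>
    rw [Prog.repr, Prog.repr, substF_inf, ih]
    simp only [substF, BoundedFormula.ex, BoundedFormula.not, ih, substF_fLt]
    congr 1
    · congr 2
      · simp
      · congr 4
        · funext i
          refine Fin.lastCases ?_ (fun i => ?_) i <;> simp
        · simp
    · congr 1
      · funext i
        refine Fin.lastCases ?_ (fun i => ?_) i <;> simp
      · simp

end SubstitutionArith

/-! ### Derived rules of natural deduction -/

section DerivedRules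

variable {L : FirstOrder.Language.{u, v}} {n : ℕ} {Γ Δ : Set (Fm L n)} {A B C : Fm L n}

theorem Deriv.mono (h : Deriv Γ A) (hs : Γ ⊆ Δ) : Deriv Δ A := by
  induction h with
  | ax h => exact .ax (hs h)
  | impI _ ih => exact .impI (ih (Set.insert_subset_insert hs))
  | impE _ _ ih₁ ih₂ => exact .impE (ih₁ hs) (ih₂ hs)
  | contra _ ih => exact .contra (ih (Set.insert_subset_insert hs))
  | allI _ ih => exact .allI (ih (Set.image_mono hs))
  | allE _ t ih => exact .allE (ih hs) t
  | eqI t => exact .eqI t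
  | eqE A _ _ ih₁ ih₂ => exact .eqE A (ih₁ hs) (ih₂ hs)

/-- Induction on the derivation with `σ` arbitrary: the premise of `allI` lives in the shifted
context, where the hypothesis is used for `liftS σ`. The case needed later is weakening by a fresh
variable. -/
theorem Deriv.subst (h : Deriv Γ A) {k : ℕ} (σ : Fin n → Tm L k) :
    Deriv ((substF · σ) '' Γ) (substF A σ) := by
  induction h generalizing k with
  | ax h => exact .ax (Set.mem_image_of_mem _ h)
  | impI _ ih =>
    refine .impI ?_
    have := ih σ
    rwa [Set.image_insert_eq] at this
  | impE _ _ ih₁ ih₂ => exact .impE (ih₁ σ) (ih₂ σ)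
  | contra _ ih =>
    refine .contra ?_
    have := ih σ
    rwa [Set.image_insert_eq] at this
  | allI _ ih =>
    refine .allI ?_
    have := ih (liftS σ)
    rw [Set.image_image] at this ⊢
    simpa only [wkF_substF] using this
  | allE _ t ih =>
    rw [substF_inst]
    exact .allE (ih σ) _
  | eqI t => exact .eqI _
  | eqE A _ _ ih₁ ih₂ =>
    rw [substF_inst]
    refine .eqE _ (ih₁ σ) ?_
    rw [← substF_inst]
    exact ih₂ σ

theorem Deriv.weaken (h : Deriv Γ A) : Deriv (wkF '' Γ) (wkF A) := h.subst _

theorem Deriv.thin (h : Deriv Γ A) : Deriv (insert B Γ) A := h.mono (Set.subset_insert _ _)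

theorem Deriv.hyp : Deriv (insert A Γ) A := .ax (Set.mem_insert _ _)

theorem Deriv.cut (h : Deriv Γ A) (h' : Deriv (insert A Γ) B) : Deriv Γ B :=
  .impE (.impI h') h

theorem Deriv.exfalso (h : Deriv Γ BoundedFormula.falsum) : Deriv Γ A := .contra h.thin

theorem Deriv.andI (h₁ : Deriv Γ A) (h₂ : Deriv Γ B) : Deriv Γ (A ⊓ B) :=
  .impI (.impE (.impE .hyp h₁.thin) h₂.thin)

theorem Deriv.orI_left (h : Deriv Γ A) : Deriv Γ (A ⊔ B) :=
  .impI (.exfalso (.impE .hyp h.thin))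

theorem Deriv.orI_right (h : Deriv Γ B) : Deriv Γ (A ⊔ B) := .impI h.thin

theorem Deriv.byCases (h₁ : Deriv (insert A Γ) C) (h₂ : Deriv (insert A.not Γ) C) :
    Deriv Γ C := by
  have h : Deriv (insert C.not Γ) A.not :=
    .impI (.impE (Deriv.hyp.thin) (h₁.mono (Set.insert_subset_insert (Set.subset_insert _ _))))
  exact .contra (.impE .hyp
    (h.cut (h₂.mono (Set.insert_subset_insert (Set.subset_insert _ _)))))

theorem Deriv.exI {A : Fm L (n + 1)} (t : Tm L n) (h : Deriv Γ (inst A t)) : Deriv Γ A.ex :=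
  .impI (.impE (.allE (A := A.not) .hyp t) h.thin)

theorem Deriv.exE {A : Fm L (n + 1)} (h : Deriv Γ A.ex)
    (h' : Deriv (insert A (wkF '' Γ)) (wkF C)) : Deriv Γ C := by
  refine .contra (.impE h.thin (.allI (.impI (.impE (A := wkF C) ?_ (h'.mono ?_)))))
  -- The assumption `C.not` survives the shift as `wkF C.not`, which unfolds to the negation of `wkF
  -- C`.
  · exact .ax (Or.inr (Set.mem_image_of_mem wkF (Set.mem_insert _ _)))
  · exact Set.insert_subset_insert (Set.image_mono (Set.subset_insert _ _))

/-- Leibniz's rule for the formula `c[s] = c[x]`, where the hole `x` is the last variable; at `s` it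
is reflexivity. -/
theorem Deriv.congr {s t : Tm L n} (c : Tm L (n + 1))
    (h : Deriv Γ (BoundedFormula.equal s t)) :
    Deriv Γ (BoundedFormula.equal (substT (Fin.snoc bv s) c) (substT (Fin.snoc bv t) c)) := by
  have := Deriv.eqE (BoundedFormula.equal (wkT (substT (Fin.snoc bv s) c)) c) h
    (by simpa [inst, substF] using .eqI _)
  simpa [inst, substF] using this

theorem Deriv.symm {s t : Tm L n} (h : Deriv Γ (BoundedFormula.equal s t)) :
    Deriv Γ (BoundedFormula.equal t s) := by
  have := Deriv.eqE (BoundedFormula.equal (bv (Fin.last n)) (wkT s)) h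
    (by simpa [inst, substF] using .eqI _)
  simpa [inst, substF] using this

theorem Deriv.trans {s t r : Tm L n} (h : Deriv Γ (BoundedFormula.equal s t))
    (h' : Deriv Γ (BoundedFormula.equal t r)) : Deriv Γ (BoundedFormula.equal s r) := by
  have := Deriv.eqE (BoundedFormula.equal (wkT s) (bv (Fin.last n))) h'
    (by simpa [inst, substF] using h)
  simpa [inst, substF] using this

theorem Deriv.exN {l : ℕ} {A : Fm L (n + l)} (s : Fin l → Tm L n)
    (h : Deriv Γ (substF A (Fin.append bv s))) : Deriv Γ (exN l A) := by
  induction l with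
  | zero =>
    have : Fin.append bv s = (bv : Fin n → Tm L n) := by
      funext i
      exact Fin.append_left bv s i
    rw [this, substF_bv] at h
    exact h
  | succ l ih =>
    -- The last variable is bound innermost, so its witness is supplied once the others have been
    -- substituted.
    refine ih (A := A.ex) (fun i => s i.castSucc) (.exI (s (Fin.last l)) ?_)
    rw [inst_substF_liftS]
    have hs : (Fin.snoc (Fin.append bv fun i : Fin l => s i.castSucc) (s (Fin.last l)) :
        Fin (n + l + 1) → Tm L n) = Fin.append bv s := ?_
    · exact (congrArg (substF A) hs).symm ▸ h
    funext i
    refine Fin.lastCases ?_ (fun i => ?_) i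
    · rw [Fin.snoc_last]
      exact (Fin.append_right bv s (Fin.last l)).symm
    · rw [Fin.snoc_castSucc]
      refine Fin.addCases (fun i => ?_) (fun i => ?_) i
      · rw [Fin.append_left]
        exact (Fin.append_left bv s i).symm
      · rw [Fin.append_right]
        exact (Fin.append_right bv s i.castSucc).symm

theorem Deriv.conjN {l : ℕ} {B : Fin l → Fm L n} (hB : ∀ i, Deriv Γ (B i)) (hC : Deriv Γ C) :
    Deriv Γ (conjN B C) := by
  have h : ∀ D ∈ List.ofFn B, Deriv Γ D := by
    intro D hD
    obtain ⟨i, rfl⟩ := (List.mem_ofFn' _ _).1 hD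
    exact hB i
  unfold Arithmetic.conjN
  revert h
  induction List.ofFn B with
  | nil => exact fun _ => hC
  | cons D l ih =>
    exact fun h => .andI (h D (by simp)) (ih fun E hE => h E (by simp [hE]))

end DerivedRules

/-! ### Derivations in Robinson's arithmetic -/

section RobinsonDerivations

variable {L' : FirstOrder.Language.{u, v}} {n : ℕ} {Γ Δ : Set (Fm (LA L') n)}
  {s t : Tm (LA L') n} {C : Fm (LA L') n}

/-- The axioms of Robinson's arithmetic are derivable from the hypotheses in `Γ`. -/
def ProvesRobinson (Γ : Set (Fm (LA L') n)) : Prop :=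
  ∀ φ ∈ robinson L', Deriv Γ (substF φ (Fin.elim0 : Fin 0 → Tm (LA L') n))

namespace ProvesRobinson

theorem mono (hΓ : ProvesRobinson Γ) (h : Γ ⊆ Δ) : ProvesRobinson Δ :=
  fun φ hφ => (hΓ φ hφ).mono h

theorem thin (hΓ : ProvesRobinson Γ) : ProvesRobinson (insert C Γ) :=
  hΓ.mono (Set.subset_insert _ _)

theorem weaken (hΓ : ProvesRobinson Γ) : ProvesRobinson (wkF '' Γ) := fun φ hφ => by
  have := (hΓ φ hφ).weaken
  rw [wkF, substF_substF] at this
  convert this using 2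

theorem inst_all {A : Fm (LA L') 1} (hΓ : ProvesRobinson Γ) (h : A.all ∈ robinson L')
    (t : Tm (LA L') n) : Deriv Γ (substF A fun _ => t) := by
  have := (hΓ _ h).allE t
  rw [inst_substF_liftS] at this
  convert this using 2
  funext i
  rw [Subsingleton.elim i (Fin.last 0), Fin.snoc_last]

theorem inst_all_all {A : Fm (LA L') 2} (hΓ : ProvesRobinson Γ) (h : A.all.all ∈ robinson L')
    (s t : Tm (LA L') n) : Deriv Γ (substF A ![s, t]) := by
  have := (hΓ.inst_all h s).allE t
  rw [inst_substF_liftS] at this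
  convert this using 2
  funext i
  fin_cases i <;> rfl

theorem succ_ne_zero (hΓ : ProvesRobinson Γ) (h : Deriv Γ (fEq (tSucc t) tZero)) :
    Deriv Γ C := by
  have := hΓ.inst_all (Set.mem_insert _ _) t
  simp only [substF, fEq, substT_tSucc, substT_tZero, substT_bv_apply] at this
  exact .exfalso (.impE this h)

theorem succ_inj (hΓ : ProvesRobinson Γ) (h : Deriv Γ (fEq (tSucc s) (tSucc t))) :
    Deriv Γ (fEq s t) := by
  have := hΓ.inst_all_all (Or.inr (Or.inl rfl)) s t
  simp only [substF, fEq, substT_tSucc, substT_bv_apply] at this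
  exact .impE this h

theorem cases (hΓ : ProvesRobinson Γ) (t : Tm (LA L') n)
    (h₀ : Deriv (insert (fEq t tZero) Γ) C)
    (h₁ : Deriv (insert (fEq (wkT t) (tSucc (bv (Fin.last n)))) (wkF '' Γ)) (wkF C)) :
    Deriv Γ C := by
  refine .byCases h₀ ?_
  have := hΓ.inst_all (Or.inr (Or.inr (Or.inl rfl))) t
  rw [substF, BoundedFormula.not, substF] at this
  refine Deriv.exE (.impE this.thin ?_) (h₁.mono ?_)
  · simp only [substF, fEq, substT_tZero, substT_bv_apply]
    exact .hyp
  · refine Set.insert_subset (Or.inl ?_)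
      ((Set.image_mono (Set.subset_insert _ _)).trans (Set.subset_insert _ _))
    simp only [substF, fEq, substT_tSucc, substT_bv_apply]
    rfl

theorem add_zero (hΓ : ProvesRobinson Γ) : Deriv Γ (fEq (tAdd t tZero) t) := by
  have := hΓ.inst_all (Or.inr (Or.inr (Or.inr (Or.inl rfl)))) t
  simpa only [substF_fEq, substT_tAdd, substT_tZero, substT_bv_apply] using this

theorem add_succ (hΓ : ProvesRobinson Γ) :
    Deriv Γ (fEq (tAdd s (tSucc t)) (tSucc (tAdd s t))) := by
  have := hΓ.inst_all_all (Or.inr (Or.inr (Or.inr (Or.inr (Or.inl rfl))))) s t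
  simpa only [substF_fEq, substT_tAdd, substT_tSucc, substT_bv_apply, Matrix.cons_val_zero,
    Matrix.cons_val_one] using this

theorem mul_zero (hΓ : ProvesRobinson Γ) : Deriv Γ (fEq (tMul t tZero) tZero) := by
  have := hΓ.inst_all (Or.inr (Or.inr (Or.inr (Or.inr (Or.inr (Or.inl rfl)))))) t
  simpa only [substF_fEq, substT_tMul, substT_tZero, substT_bv_apply] using this

theorem mul_succ (hΓ : ProvesRobinson Γ) :
    Deriv Γ (fEq (tMul s (tSucc t)) (tAdd (tMul s t) s)) := by
  have := hΓ.inst_all_all (Or.inr (Or.inr (Or.inr (Or.inr (Or.inr (Or.inr rfl)))))) s t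
  simpa only [substF_fEq, substT_tAdd, substT_tMul, substT_tSucc, substT_bv_apply,
    Matrix.cons_val_zero, Matrix.cons_val_one] using this

end ProvesRobinson

theorem Deriv.succ_congr (h : Deriv Γ (fEq s t)) : Deriv Γ (fEq (tSucc s) (tSucc t)) := by
  have := Deriv.congr (tSucc (bv (Fin.last n))) h
  simpa [fEq] using this

theorem Deriv.add_congr_left (r : Tm (LA L') n) (h : Deriv Γ (fEq s t)) :
    Deriv Γ (fEq (tAdd s r) (tAdd t r)) := by
  have := Deriv.congr (tAdd (bv (Fin.last n)) (wkT r)) h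
  simpa [fEq] using this

theorem wkF_fEq (s t : Tm (LA L') n) : wkF (fEq s t) = fEq (wkT s) (wkT t) := rfl

theorem wkF_fLt (s t : Tm (LA L') n) : wkF (fLt s t) = fLt (wkT s) (wkT t) := substF_fLt _ _ _

theorem inst_fEq (s t : Tm (LA L') (n + 1)) (r : Tm (LA L') n) :
    inst (fEq s t) r = fEq (substT (Fin.snoc bv r) s) (substT (Fin.snoc bv r) t) := rfl

theorem inst_fLt (s t : Tm (LA L') (n + 1)) (r : Tm (LA L') n) :
    inst (fLt s t) r = fLt (substT (Fin.snoc bv r) s) (substT (Fin.snoc bv r) t) :=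
  substF_fLt _ _ _

theorem Deriv.fLe_of_add (r : Tm (LA L') n) (h : Deriv Γ (fEq (tAdd r s) t)) :
    Deriv Γ (fLe s t) :=
  .exI r (by simpa [inst_fEq] using h)

namespace ProvesRobinson

theorem numeral_add (hΓ : ProvesRobinson Γ) (a b : ℕ) :
    Deriv Γ (fEq (tAdd (numeral a) (numeral b)) (numeral (a + b))) := by
  induction b with
  | zero => exact hΓ.add_zero
  | succ b ih => exact hΓ.add_succ.trans ih.succ_congr

theorem numeral_mul (hΓ : ProvesRobinson Γ) (a b : ℕ) :
    Deriv Γ (fEq (tMul (numeral a) (numeral b)) (numeral (a * b))) := by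
  induction b with
  | zero => exact hΓ.mul_zero
  | succ b ih => exact hΓ.mul_succ.trans ((ih.add_congr_left _).trans (hΓ.numeral_add _ _))

theorem numeral_le (hΓ : ProvesRobinson Γ) {a b : ℕ} (h : a ≤ b) :
    Deriv Γ (fLe (numeral a) (numeral b)) := by
  have := hΓ.numeral_add (b - a) a
  rw [Nat.sub_add_cancel h] at this
  exact this.fLe_of_add

/-- A witness `z` satisfies `z + S(t) = 0`, and the recursion for addition turns the left side into
a successor. -/
theorem not_lt_zero (hΓ : ProvesRobinson Γ) (h : Deriv Γ (fLt t tZero)) : Deriv Γ C := by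
  refine .exE h (hΓ.weaken.thin.succ_ne_zero (t := tAdd (bv (Fin.last n)) (wkT t))
    (hΓ.weaken.thin.add_succ.symm.trans ?_))
  simpa [fEq] using Deriv.hyp

/-- The same witness serves: `z + S(S(s)) = S(t)` becomes `S(z + S(s)) = S(t)`, and one successor
cancels. -/
theorem lt_of_succ_lt_succ (hΓ : ProvesRobinson Γ) (h : Deriv Γ (fLt (tSucc s) (tSucc t))) :
    Deriv Γ (fLt s t) := by
  refine .exE h ?_
  rw [wkF_fLt]
  refine .fLe_of_add (bv (Fin.last n)) (hΓ.weaken.thin.succ_inj ?_)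
  refine hΓ.weaken.thin.add_succ.symm.trans ?_
  simpa [fEq] using Deriv.hyp

/-- In Robinson's arithmetic, `t < q` for a numeral `q` implies `t = 0`, …, or `t = q - 1`. -/
theorem lt_numeral_cases {q : ℕ} (hΓ : ProvesRobinson Γ) (hlt : Deriv Γ (fLt t (numeral q)))
    (h : ∀ i < q, Deriv (insert (fEq t (numeral i)) Γ) C) : Deriv Γ C := by
  induction q generalizing n with
  | zero => exact hΓ.not_lt_zero hlt
  | succ q ih =>
    -- The theory has no induction scheme, so the induction on `q` is external. Inside, `t` is `0`
    -- or a successor `S(x)`, and then `x < q`.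
    refine hΓ.cases t (h 0 q.succ_pos) ?_
    have hΔ := hΓ.weaken.thin (C := fEq (wkT t) (tSucc (bv (Fin.last n))))
    refine ih (t := bv (Fin.last n)) hΔ (hΔ.lt_of_succ_lt_succ ?_) fun i hi => ?_
    · have h₁ := Deriv.eqE (Γ := insert (fEq (wkT t) (tSucc (bv (Fin.last n)))) (wkF '' Γ))
        (fLt (bv (Fin.last (n + 1))) (numeral (q + 1))) .hyp
        (by simpa [inst_fLt, wkF_fLt] using hlt.weaken.thin)
      simpa [inst_fLt, numeral] using h₁
    · have h₁ := (h (i + 1) (Nat.succ_lt_succ hi)).weaken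
      rw [Set.image_insert_eq, wkF_fEq, wkT_numeral] at h₁
      -- From `t = S(x)` and `x = i` follows `t = i + 1`, a case covered by `h`.
      refine Deriv.cut ?_ (h₁.mono (Set.insert_subset_insert
        ((Set.subset_insert _ _).trans (Set.subset_insert _ _))))
      exact Deriv.hyp.thin.trans Deriv.hyp.succ_congr

end ProvesRobinson

end RobinsonDerivations

/-! ### Terminating computations are provable -/

section Representability

theorem Prog.mem_eval_comp {n m : ℕ} (h : Prog m) (g : Fin m → Prog n) (x : Fin n → ℕ) (q : ℕ) :
    q ∈ (Prog.comp h g).eval x ↔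
      ∃ w : Fin m → ℕ, (∀ i, w i ∈ (g i).eval x) ∧ q ∈ h.eval w := by
  simp only [Prog.eval, Part.mem_bind_iff]
  constructor
  · rintro ⟨w, ⟨d, rfl⟩, hq⟩
    exact ⟨_, fun i => Part.get_mem _, hq⟩
  · rintro ⟨w, hw, hq⟩
    exact ⟨w, ⟨fun i => (hw i).1, funext fun i => (hw i).2⟩, hq⟩

/-- Nonzero values are written `w + 1` to match the `S(w)` in the representing proposition. -/
theorem Prog.mem_eval_mu {n : ℕ} (g : Prog (n + 1)) (x : Fin n → ℕ) (q : ℕ) :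
    q ∈ (Prog.mu g).eval x ↔
      0 ∈ g.eval (Fin.snoc x q) ∧ ∀ z < q, ∃ w, w + 1 ∈ g.eval (Fin.snoc x z) := by
  refine Nat.mem_rfind.trans (and_congr ?_ (forall_congr' fun z => ?_))
  · simp
  · refine imp_congr_right fun _ => ?_
    simp only [Part.mem_map_iff, decide_eq_false_iff_not]
    constructor
    · rintro ⟨w, hw, h0⟩
      exact ⟨w - 1, by rwa [Nat.sub_add_cancel (Nat.pos_of_ne_zero h0)]⟩
    · rintro ⟨w, hw⟩
      exact ⟨w + 1, hw, Nat.succ_ne_zero w⟩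

variable {L' : FirstOrder.Language.{u, v}}

theorem snoc_numeral {a n : ℕ} (p : Fin a → ℕ) (z : ℕ) :
    (Fin.snoc (fun i => numeral (p i)) (numeral z) : Fin (a + 1) → Tm (LA L') n) =
      fun i => numeral ((Fin.snoc p z : Fin (a + 1) → ℕ) i) := by
  funext i
  refine Fin.lastCases ?_ (fun i => ?_) i <;> simp

theorem ProvesRobinson.repr {a : ℕ} (f : Prog a) {n : ℕ} {Γ : Set (Fm (LA L') n)}
    (hΓ : ProvesRobinson Γ) {p : Fin a → ℕ} {q : ℕ} (hq : q ∈ f.eval p) :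
    Deriv Γ (f.repr (fun i => numeral (p i)) (numeral q)) := by
  induction f generalizing n q with
  | proj i =>
    obtain rfl := Part.mem_some_iff.1 hq
    exact .eqI _
  | zero k =>
    obtain rfl := Part.mem_some_iff.1 hq
    exact .eqI _
  | succ =>
    obtain rfl := Part.mem_some_iff.1 hq
    exact .eqI _
  | add =>
    obtain rfl := Part.mem_some_iff.1 hq
    exact (hΓ.numeral_add _ _).symm
  | mul =>
    obtain rfl := Part.mem_some_iff.1 hq
    exact (hΓ.numeral_mul _ _).symm
  | leq =>
    obtain rfl := Part.mem_some_iff.1 hq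
    by_cases h : p 0 ≤ p 1
    · rw [if_pos h]
      exact .orI_left (.andI (hΓ.numeral_le h) (.eqI _))
    · rw [if_neg h]
      exact .orI_right (.andI (hΓ.numeral_le (Nat.lt_of_not_le h)) (.eqI _))
  | comp h g ihh ihg =>
    obtain ⟨w, hw, hq⟩ := (Prog.mem_eval_comp h g p q).1 hq
    refine .exN (fun i => numeral (w i)) ?_
    simp only [substF_conjN, substF_repr, wkTN_numeral, substT_numeral, substT_bv_apply,
      Fin.append_right]
    exact .conjN (fun i => ihg i hΓ (hw i)) (ihh hΓ hq)
  | mu g ih =>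
    obtain ⟨h0, hlt⟩ := (Prog.mem_eval_mu g p q).1 hq
    refine .andI (.allI (.impI ?_)) ?_
    -- The bound variable `z < q` is replaced by one of finitely many numerals, at each of which `g`
    -- has a known nonzero value.
    · refine hΓ.weaken.thin.lt_numeral_cases (t := bv (Fin.last n)) (q := q)
        (by simpa using Deriv.hyp) fun i hi => ?_
      obtain ⟨w, hw⟩ := hlt i hi
      refine .exI (numeral w) ?_
      rw [inst, substF_repr]
      -- The induction hypothesis, which concerns the numeral of `i`, is carried over to `z` by
      -- Leibniz's rule for `i = z`.
      have h₁ := Deriv.eqE (Γ := insert (fEq (bv (Fin.last n)) (numeral i))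
          (insert (fLt (bv (Fin.last n)) (wkT (numeral q))) (wkF '' Γ)))
        (g.repr (Fin.snoc (fun i => numeral (p i)) (bv (Fin.last (n + 1)))) (numeral (w + 1)))
        (Deriv.symm .hyp) (by
          rw [inst, substF_repr]
          convert ih hΓ.weaken.thin.thin hw using 2
          · funext j
            refine Fin.lastCases ?_ (fun j => ?_) j <;> simp
          · simp)
      rw [inst, substF_repr] at h₁
      convert h₁ using 2
      · funext j
        refine Fin.lastCases ?_ (fun j => ?_) j <;> simp
      · simp [numeral]
    · rw [snoc_numeral]
      exact ih hΓ h0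

end Representability

/-! ### Soundness of natural deduction -/

section Soundness

variable {L : FirstOrder.Language.{u, v}} {M : Type*} [L.Structure M] {m n : ℕ} (v : Empty → M)

@[simp]
theorem realize_bv (i : Fin n) (xs : Fin n → M) :
    (bv i : Tm L n).realize (Sum.elim v xs) = xs i := rfl

theorem realize_substT (σ : Fin m → Tm L n) (t : Tm L m) (xs : Fin n → M) :
    (substT σ t).realize (Sum.elim v xs) =
      t.realize (Sum.elim v fun i => (σ i).realize (Sum.elim v xs)) := by
  induction t using Tm.ind with
  | hv i => rfl
  | hf l f ts ih => simp [ih]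

@[simp]
theorem realize_wkT (t : Tm L n) (xs : Fin n → M) (x : M) :
    (wkT t).realize (Sum.elim v (Fin.snoc xs x : Fin (n + 1) → M)) =
      t.realize (Sum.elim v xs) := by
  simp [wkT, realize_substT]

@[simp]
theorem realize_wkTN (l : ℕ) (t : Tm L n) (xs : Fin n → M) (ys : Fin l → M) :
    (wkTN l t).realize (Sum.elim v (Fin.append xs ys)) = t.realize (Sum.elim v xs) := by
  simp [wkTN, realize_substT]

theorem realize_liftS (σ : Fin m → Tm L n) (xs : Fin n → M) (x : M) :
    (fun i => (liftS σ i).realize (Sum.elim v (Fin.snoc xs x : Fin (n + 1) → M))) =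
      Fin.snoc (fun i => (σ i).realize (Sum.elim v xs)) x := by
  funext i
  refine Fin.lastCases ?_ (fun i => ?_) i <;> simp

theorem realize_substF (A : Fm L m) {n : ℕ} (σ : Fin m → Tm L n) (xs : Fin n → M) :
    (substF A σ).Realize v xs ↔ A.Realize v fun i => (σ i).realize (Sum.elim v xs) := by
  induction A generalizing n with
  | falsum => rfl
  | equal t u => simp [substF, BoundedFormula.Realize, realize_substT]
  | rel R ts => simp [substF, BoundedFormula.Realize, realize_substT]
  | imp A B ihA ihB => simp [substF, ihA, ihB]
  | all A ih => simp [substF, ih, realize_liftS]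

@[simp]
theorem realize_wkF (A : Fm L n) (xs : Fin n → M) (x : M) :
    (wkF A).Realize v (Fin.snoc xs x : Fin (n + 1) → M) ↔ A.Realize v xs := by
  simp [wkF, realize_substF]

theorem realize_inst (A : Fm L (n + 1)) (t : Tm L n) (xs : Fin n → M) :
    (inst A t).Realize v xs ↔
      A.Realize v (Fin.snoc xs (t.realize (Sum.elim v xs)) : Fin (n + 1) → M) := by
  rw [inst, realize_substF]
  have : (fun i => ((Fin.snoc bv t : Fin (n + 1) → Tm L n) i).realize (Sum.elim v xs)) =
      (Fin.snoc xs (t.realize (Sum.elim v xs)) : Fin (n + 1) → M) := by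
    funext i
    refine Fin.lastCases ?_ (fun i => ?_) i <;> simp
  rw [this]

theorem Deriv.sound {Γ : Set (Fm L n)} {A : Fm L n} (h : Deriv Γ A) (xs : Fin n → M)
    (hΓ : ∀ B ∈ Γ, B.Realize v xs) : A.Realize v xs := by
  induction h with
  | ax h => exact hΓ _ h
  | impI _ ih => exact fun hA => ih xs (Set.forall_mem_insert.2 ⟨hA, hΓ⟩)
  | impE _ _ ih₁ ih₂ => exact ih₁ xs hΓ (ih₂ xs hΓ)
  | contra _ ih => exact by_contra fun hA => ih xs (Set.forall_mem_insert.2 ⟨hA, hΓ⟩)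
  | allI _ ih =>
    exact fun x => ih _ (Set.forall_mem_image.2 fun B hB => (realize_wkF v B xs x).2 (hΓ B hB))
  | allE _ t ih => exact (realize_inst v _ t xs).2 (ih xs hΓ _)
  | eqI t => exact rfl
  | eqE A _ _ ih₁ ih₂ =>
    have h₁ := ih₁ xs hΓ
    have h₂ := ih₂ xs hΓ
    rw [realize_inst] at h₂ ⊢
    rwa [← show _ = _ from h₁]

theorem realize_exN (l : ℕ) (A : Fm L (n + l)) (xs : Fin n → M) :
    (exN l A).Realize v xs ↔ ∃ ys : Fin l → M, A.Realize v (Fin.append xs ys) := by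
  induction l with
  | zero =>
    have (ys : Fin 0 → M) : Fin.append xs ys = xs := by
      funext i
      exact Fin.append_left xs ys i
    simp only [this, exists_const]
    rfl
  | succ l ih =>
    refine (ih A.ex).trans ?_
    have (ys : Fin l → M) (y : M) : (Fin.snoc (Fin.append xs ys) y : Fin (n + l + 1) → M) =
        Fin.append xs (Fin.snoc ys y : Fin (l + 1) → M) := (Fin.append_snoc xs ys y).symm
    simp only [BoundedFormula.realize_ex]
    constructor
    · rintro ⟨ys, y, h⟩
      exact ⟨Fin.snoc ys y, this ys y ▸ h⟩
    · rintro ⟨ys, h⟩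
      refine ⟨fun i => ys i.castSucc, ys (Fin.last l), ?_⟩
      rw [this]
      exact (Fin.snoc_init_self ys).symm ▸ h

theorem realize_conjN {l : ℕ} (B : Fin l → Fm L n) (C : Fm L n) (xs : Fin n → M) :
    (conjN B C).Realize v xs ↔ (∀ i, (B i).Realize v xs) ∧ C.Realize v xs := by
  have : (∀ i, (B i).Realize v xs) ↔ ∀ D ∈ List.ofFn B, D.Realize v xs := by
    simp
  rw [this, conjN]
  induction List.ofFn B with
  | nil => simp
  | cons D l ih => simp [ih, and_assoc]

end Soundness

/-! ### Representing propositions in the standard model -/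

section Semantics

variable {L' : FirstOrder.Language.{u, v}} [L'.Structure ℕ] {n : ℕ} (v : Empty ⊕ Fin n → ℕ)

@[simp]
theorem realize_tZero : (tZero : Tm (LA L') n).realize v = 0 := rfl

@[simp]
theorem realize_tSucc (t : Tm (LA L') n) : (tSucc t).realize v = t.realize v + 1 := rfl

@[simp]
theorem realize_tAdd (s t : Tm (LA L') n) :
    (tAdd s t).realize v = s.realize v + t.realize v := rfl

@[simp]
theorem realize_tMul (s t : Tm (LA L') n) :
    (tMul s t).realize v = s.realize v * t.realize v := rfl

@[simp]
theorem realize_numeral (p : ℕ) : (numeral p : Tm (LA L') n).realize v = p := by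
  induction p with
  | zero => rfl
  | succ p ih => simp [numeral, ih]

theorem realize_fEq (s t : Tm (LA L') n) (v : Empty → ℕ) (xs : Fin n → ℕ) :
    (fEq s t).Realize v xs ↔ s.realize (Sum.elim v xs) = t.realize (Sum.elim v xs) := Iff.rfl

theorem realize_fLe (s t : Tm (LA L') n) (v : Empty → ℕ) (xs : Fin n → ℕ) :
    (fLe s t).Realize v xs ↔ s.realize (Sum.elim v xs) ≤ t.realize (Sum.elim v xs) := by
  simp only [fLe, BoundedFormula.realize_ex, realize_fEq, realize_tAdd, realize_wkT, realize_bv,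
    Fin.snoc_last]
  exact ⟨fun ⟨a, ha⟩ => ha ▸ Nat.le_add_left _ _, fun h => ⟨_, Nat.sub_add_cancel h⟩⟩

theorem realize_fLt (s t : Tm (LA L') n) (v : Empty → ℕ) (xs : Fin n → ℕ) :
    (fLt s t).Realize v xs ↔ s.realize (Sum.elim v xs) < t.realize (Sum.elim v xs) :=
  realize_fLe _ _ _ _

/-- Over `ℕ` each clause of `Prog.repr` says what the matching clause of `Prog.eval` computes; the
interpretation of the additional symbols plays no role. -/
theorem realize_repr {a : ℕ} (f : Prog a) {n : ℕ} (t : Fin a → Tm (LA L') n) (y : Tm (LA L') n)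
    (v : Empty → ℕ) (xs : Fin n → ℕ) :
    (f.repr t y).Realize v xs ↔
      y.realize (Sum.elim v xs) ∈ f.eval fun i => (t i).realize (Sum.elim v xs) := by
  induction f generalizing n with
  | proj i => simp [Prog.repr, Prog.eval, realize_fEq]
  | zero k => simp [Prog.repr, Prog.eval, realize_fEq]
  | succ => simp [Prog.repr, Prog.eval, realize_fEq]
  | add => simp [Prog.repr, Prog.eval, realize_fEq]
  | mul => simp [Prog.repr, Prog.eval, realize_fEq]
  | leq =>
    simp only [Prog.repr, Prog.eval, BoundedFormula.realize_sup, BoundedFormula.realize_inf,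
      realize_fEq, realize_fLe, realize_fLt, realize_tSucc, realize_tZero, Part.mem_some_iff]
    split_ifs <;> omega
  | comp h g ihh ihg =>
    simp [Prog.repr, Prog.mem_eval_comp, realize_exN, realize_conjN, ihh, ihg]
  | mu g ih =>
    rw [Prog.repr, Prog.mem_eval_mu, BoundedFormula.realize_inf, and_comm, ih]
    refine and_congr ?_ (forall_congr' fun z => ?_)
    · rw [realize_tZero]
      refine iff_of_eq (congrArg (fun p => 0 ∈ g.eval p) ?_)
      funext i
      refine Fin.lastCases ?_ (fun i => ?_) i <;> simp
    · rw [BoundedFormula.realize_imp, realize_fLt, realize_wkT, realize_bv, Fin.snoc_last,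
        BoundedFormula.realize_ex]
      refine imp_congr_right fun _ => exists_congr fun w => ?_
      rw [ih, realize_tSucc, realize_bv, Fin.snoc_last]
      refine iff_of_eq (congrArg (fun p => w + 1 ∈ g.eval p) ?_)
      funext i
      refine Fin.lastCases ?_ (fun i => ?_) i <;> simp

end Semantics

/-! ### Provability of halting sentences -/

section Provability

variable {L' : FirstOrder.Language.{u, v}} {T : (LA L').Theory}

theorem ExtendsRobinson.provesRobinson (hT : ExtendsRobinson T) :
    ProvesRobinson (L' := L') (n := 0) T := fun φ hφ => by
  have h : substF φ (Fin.elim0 : Fin 0 → Tm (LA L') 0) = φ := by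
    rw [Subsingleton.elim (Fin.elim0 : Fin 0 → Tm (LA L') 0) bv, substF_bv]
  rw [h]
  exact hT φ hφ

theorem Provable.realize [L'.Structure ℕ] (hM : ℕ ⊨ T) {φ : (LA L').Sentence} (h : Provable T φ) :
    BoundedFormula.Realize φ (default : Empty → ℕ) (default : Fin 0 → ℕ) := by
  refine Deriv.sound (M := ℕ) default h default fun B hB => ?_
  have := hM.realize_of_mem B hB
  unfold Sentence.Realize Formula.Realize at this
  convert this

theorem not_provable_falsum (hT : HasStandardModel T) :
    ¬ Provable T (BoundedFormula.falsum : (LA L').Sentence) := by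
  obtain ⟨_, hM⟩ := hT
  exact fun h => Provable.realize hM h

theorem provable_haltSentence_iff (hT : ExtendsRobinson T) (hM : HasStandardModel T) {n : ℕ}
    (f : Prog n) (p : Fin n → ℕ) : Provable T (f.haltSentence L' p) ↔ f.Terminates p := by
  constructor
  · intro h
    obtain ⟨_, hM⟩ := hM
    have := h.realize hM
    rw [Prog.haltSentence, BoundedFormula.realize_ex] at this
    obtain ⟨q, hq⟩ := this
    rw [realize_repr] at hq
    simp only [realize_numeral] at hq
    exact Part.dom_iff_mem.2 ⟨_, hq⟩
  · intro h
    obtain ⟨q, hq⟩ := Part.dom_iff_mem.1 h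
    refine .exI (numeral q) ?_
    rw [inst, substF_repr]
    convert hT.provesRobinson.repr f hq using 2
    · simp
    · exact Fin.snoc_last (α := fun _ => Tm (LA L') 0) (numeral q) bv

end Provability

/-! ### Programs compute all primitive recursive functions -/

section TotalFunctions

open Classical in
/-- The characteristic function of a predicate, with value `0` where the predicate holds. -/
noncomputable def charFun {n : ℕ} (P : (Fin n → ℕ) → Prop) (x : Fin n → ℕ) : ℕ :=
  if P x then 0 else 1

/-- The total function `F` is computed by a program. -/
def ByProg {n : ℕ} (F : (Fin n → ℕ) → ℕ) : Prop := ∃ f : Prog n, ∀ x, f.eval x = Part.some (F x)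

/-- The characteristic function of the predicate `P` is computed by a program. -/
def ByProgPred {n : ℕ} (P : (Fin n → ℕ) → Prop) : Prop := ByProg (charFun P)

variable {m n : ℕ} {F G H : (Fin n → ℕ) → ℕ} {P Q : (Fin n → ℕ) → Prop}

theorem charFun_eq_zero {x : Fin n → ℕ} : charFun P x = 0 ↔ P x := by
  simp [charFun]

theorem charFun_of {x : Fin n → ℕ} (h : P x) : charFun P x = 0 := if_pos h

theorem charFun_of_not {x : Fin n → ℕ} (h : ¬ P x) : charFun P x = 1 := if_neg h

namespace ByProg

theorem of_eq (hF : ByProg F) (h : ∀ x, F x = G x) : ByProg G := funext h ▸ hF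

theorem proj (i : Fin n) : ByProg fun x => x i := ⟨.proj i, fun _ => rfl⟩

theorem comp {K : (Fin m → ℕ) → ℕ} {D : Fin m → (Fin n → ℕ) → ℕ} (hK : ByProg K)
    (hD : ∀ i, ByProg (D i)) : ByProg fun x => K fun i => D i x := by
  obtain ⟨k, hk⟩ := hK
  choose d hd using hD
  refine ⟨.comp k d, fun x => Part.eq_some_iff.2 ?_⟩
  refine (Prog.mem_eval_comp k d x _).2 ⟨fun i => D i x, fun i => ?_, ?_⟩
  · rw [hd]
    exact Part.mem_some _
  · rw [hk]
    exact Part.mem_some _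

theorem comp₂ {K : (Fin 2 → ℕ) → ℕ} (hK : ByProg K) (hF : ByProg F) (hG : ByProg G) :
    ByProg fun x => K ![F x, G x] := by
  refine (hK.comp (D := ![F, G]) fun i => ?_).of_eq fun x => congrArg K ?_
  · fin_cases i
    · exact hF
    · exact hG
  · funext i
    fin_cases i <;> rfl

theorem comp_init (hF : ByProg F) : ByProg fun x : Fin (n + 1) → ℕ => F (Fin.init x) :=
  hF.comp fun i => proj i.castSucc

theorem succ (hF : ByProg F) : ByProg fun x => F x + 1 :=
  comp (K := fun x => x 0 + 1) (D := fun _ : Fin 1 => F) ⟨.succ, fun _ => rfl⟩ fun _ => hF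

theorem const (k : ℕ) : ByProg fun _ : Fin n → ℕ => k := by
  induction k with
  | zero => exact ⟨.zero n, fun _ => rfl⟩
  | succ k ih => exact ih.succ

theorem add (hF : ByProg F) (hG : ByProg G) : ByProg fun x => F x + G x :=
  comp₂ (K := fun x => x 0 + x 1) ⟨.add, fun _ => rfl⟩ hF hG

theorem mul (hF : ByProg F) (hG : ByProg G) : ByProg fun x => F x * G x :=
  comp₂ (K := fun x => x 0 * x 1) ⟨.mul, fun _ => rfl⟩ hF hG

theorem leq (hF : ByProg F) (hG : ByProg G) : ByProg fun x => if F x ≤ G x then 1 else 0 :=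
  comp₂ (K := fun x => if x 0 ≤ x 1 then 1 else 0) ⟨.leq, fun _ => rfl⟩ hF hG

end ByProg

namespace ByProgPred

theorem of_iff (hP : ByProgPred P) (h : ∀ x, P x ↔ Q x) : ByProgPred Q := by
  rwa [← funext fun x => propext (h x)]

theorem eq_zero (hF : ByProg F) : ByProgPred fun x => F x = 0 := by
  -- `leq` signals truth by `1` and `charFun` by `0`; the second comparison with `0` exchanges the
  -- two.
  refine ((((hF.leq (.const 0)).leq (.const 0)))).of_eq fun x => ?_
  by_cases h : F x = 0 <;> simp [h, charFun]

theorem not (hP : ByProgPred P) : ByProgPred fun x => ¬ P x := by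
  refine (ByProg.leq hP (.const 0)).of_eq fun x => ?_
  by_cases h : P x <;> simp [h, charFun]

theorem and (hP : ByProgPred P) (hQ : ByProgPred Q) : ByProgPred fun x => P x ∧ Q x :=
  (eq_zero (ByProg.add hP hQ)).of_iff fun x => by
    rw [Nat.add_eq_zero_iff, charFun_eq_zero, charFun_eq_zero]

theorem lt (hF : ByProg F) (hG : ByProg G) : ByProgPred fun x => F x < G x :=
  (hG.leq hF).of_eq fun x => by
    by_cases h : F x < G x
    · rw [charFun_of h, if_neg (Nat.not_le.2 h)]
    · rw [charFun_of_not h, if_pos (Nat.not_lt.1 h)]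

theorem le (hF : ByProg F) (hG : ByProg G) : ByProgPred fun x => F x ≤ G x :=
  (lt hG hF).not.of_iff fun _ => Nat.not_lt

theorem eq (hF : ByProg F) (hG : ByProg G) : ByProgPred fun x => F x = G x :=
  ((le hF hG).and (le hG hF)).of_iff fun _ => Nat.le_antisymm_iff.symm

/-- Minimization of a predicate. -/
theorem find {P : (Fin n → ℕ) → ℕ → Prop}
    (hP : ByProgPred fun y : Fin (n + 1) → ℕ => P (Fin.init y) (y (Fin.last n)))
    (hF : ∀ x, P x (F x)) (hlt : ∀ x, ∀ z < F x, ¬ P x z) : ByProg F := by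
  obtain ⟨f, hf⟩ := hP
  refine ⟨.mu f, fun x => Part.eq_some_iff.2 ?_⟩
  refine (Prog.mem_eval_mu f x _).2 ⟨?_, fun z hz => ⟨0, ?_⟩⟩
  · rw [hf, charFun_of]
    · exact Part.mem_some _
    · simpa using hF x
  · rw [hf, charFun_of_not]
    · exact Part.mem_some _
    · simpa using hlt x z hz

-- The search for the first `i` that reaches the bound or violates `P` stops at `F x` at the latest,
-- and it stops no earlier exactly when `P` holds below the bound.
open Classical in
theorem forall_lt {P : (Fin n → ℕ) → ℕ → Prop}
    (hP : ByProgPred fun y : Fin (n + 1) → ℕ => P (Fin.init y) (y (Fin.last n)))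
    (hF : ByProg F) : ByProgPred fun x => ∀ i < F x, P x i := by
  have hex (x : Fin n → ℕ) : ∃ i, ¬ (i < F x ∧ P x i) := ⟨F x, by simp⟩
  have hfind : ByProg fun x => Nat.find (hex x) :=
    find (P := fun x i => ¬ (i < F x ∧ P x i)) ((lt (.proj _) hF.comp_init).and hP).not
      (fun x => Nat.find_spec (hex x)) fun x z hz => Nat.find_min (hex x) hz
  refine (le hF hfind).of_iff fun x => ?_
  rw [Nat.le_find_iff]
  simp only [not_not]
  exact ⟨fun h i hi => (h i hi).2, fun h i hi => ⟨hi, h i hi⟩⟩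

end ByProgPred

namespace ByProg

theorem sub (hF : ByProg F) (hG : ByProg G) : ByProg fun x => F x - G x :=
  ByProgPred.find (P := fun x z => F x ≤ G x + z)
    (.le hF.comp_init (hG.comp_init.add (.proj _))) (fun x => by omega) fun x z hz => by omega

open Classical in
theorem ite (hP : ByProgPred P) (hF : ByProg F) (hG : ByProg G) :
    ByProg fun x => if P x then F x else G x := by
  refine ((((const 1).sub hP).mul hF).add (ByProg.mul hP hG)).of_eq fun x => ?_
  by_cases h : P x <;> simp [h, charFun]

/-- A successor as divisor makes the search for the quotient total, and the moduli in the beta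
function have this form. -/
theorem div_succ (hF : ByProg F) (hG : ByProg G) : ByProg fun x => F x / (G x + 1) :=
  ByProgPred.find (P := fun x z => F x < (z + 1) * (G x + 1))
    (.lt hF.comp_init ((ByProg.proj _).succ.mul hG.comp_init.succ))
    (fun _ => Nat.lt_mul_of_div_lt (Nat.lt_succ_self _) (Nat.succ_pos _))
    fun _ _ hz => Nat.not_lt.2 ((Nat.le_div_iff_mul_le (Nat.succ_pos _)).1 hz)

theorem mod_succ (hF : ByProg F) (hG : ByProg G) : ByProg fun x => F x % (G x + 1) :=
  (hF.sub (hG.succ.mul (hF.div_succ hG))).of_eq fun _ =>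
    (Nat.mod_def _ _).symm

theorem sqrt (hF : ByProg F) : ByProg fun x => Nat.sqrt (F x) :=
  ByProgPred.find (P := fun x z => F x < (z + 1) * (z + 1))
    (.lt hF.comp_init ((ByProg.proj _).succ.mul (ByProg.proj _).succ))
    (fun _ => Nat.lt_succ_sqrt _)
    fun _ _ hz => Nat.not_lt.2 (Nat.le_sqrt.1 hz)

open Classical in
theorem unpair_fst (hF : ByProg F) : ByProg fun x => (F x).unpair.1 := by
  have h := hF.sub (hF.sqrt.mul hF.sqrt)
  refine (ite (.lt h hF.sqrt) h hF.sqrt).of_eq fun x => ?_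
  simp only [Nat.unpair]
  split_ifs <;> rfl

open Classical in
theorem unpair_snd (hF : ByProg F) : ByProg fun x => (F x).unpair.2 := by
  have h := hF.sub (hF.sqrt.mul hF.sqrt)
  refine (ite (.lt h hF.sqrt) hF.sqrt (h.sub hF.sqrt)).of_eq fun x => ?_
  simp only [Nat.unpair]
  split_ifs <;> rfl

theorem beta (hF : ByProg F) (hG : ByProg G) : ByProg fun x => Nat.beta (F x) (G x) :=
  hF.unpair_fst.mod_succ (hG.succ.mul hF.unpair_snd)

open Classical in
/-- Closure under primitive recursion, by means of Gödel's beta function. -/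
theorem prec {B : (Fin n → ℕ) → ℕ} {D : (Fin n → ℕ) → ℕ → ℕ → ℕ} {N : (Fin n → ℕ) → ℕ}
    (hB : ByProg B) (hN : ByProg N)
    (hD : ∀ {k : ℕ} {σ : Fin n → (Fin k → ℕ) → ℕ} {I J : (Fin k → ℕ) → ℕ},
      (∀ i, ByProg (σ i)) → ByProg I → ByProg J →
        ByProg fun x => D (fun i => σ i x) (I x) (J x)) :
    ByProg fun x => (N x).rec (B x) (D x) := by
  let R (x : Fin n → ℕ) (k : ℕ) : ℕ := k.rec (B x) (D x)
  -- `c` codes a run of the recursion: the values read off by the beta function start correctly and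
  -- follow the recursion up to `N x`.
  let P (x : Fin n → ℕ) (c : ℕ) : Prop :=
    Nat.beta c 0 = B x ∧ ∀ i < N x, Nat.beta c (i + 1) = D x i (Nat.beta c i)
  have hex (x : Fin n → ℕ) : ∃ c, P x c := by
    -- The beta function can encode any finite list, in particular that of the true values.
    let l : List ℕ := List.ofFn fun i : Fin (N x + 1) => R x i
    have hl (i : ℕ) (hi : i < N x + 1) : Nat.beta (Nat.unbeta l) i = R x i := by
      have := Nat.beta_unbeta_coe l ⟨i, by simpa [l] using hi⟩
      refine this.trans ?_
      simp only [l, Fin.getElem_fin, List.getElem_ofFn]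
    refine ⟨Nat.unbeta l, hl 0 (Nat.succ_pos _), fun i hi => ?_⟩
    rw [hl (i + 1) (Nat.succ_lt_succ hi), hl i (Nat.lt_succ_of_lt hi)]
  -- Every code of a run gives the true values, so it does not matter which one minimization finds.
  have hspec (x : Fin n → ℕ) (c : ℕ) (hc : P x c) : ∀ i ≤ N x, Nat.beta c i = R x i := by
    intro i
    induction i with
    | zero => exact fun _ => hc.1
    | succ i ih => exact fun hi => (hc.2 i hi).trans (congrArg (D x i) (ih (Nat.le_of_succ_le hi)))
  have hP : ByProgPred fun y : Fin (n + 1) → ℕ => P (Fin.init y) (y (Fin.last n)) := by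
    refine (ByProgPred.eq ((ByProg.proj _).beta (.const 0)) hB.comp_init).and ?_
    refine ByProgPred.forall_lt (P := fun y i => Nat.beta (y (Fin.last n)) (i + 1) =
      D (Fin.init y) i (Nat.beta (y (Fin.last n)) i)) ?_ hN.comp_init
    have hc : ByProg fun z : Fin (n + 1 + 1) → ℕ => Fin.init z (Fin.last n) := .proj _
    exact .eq (hc.beta (ByProg.proj _).succ)
      (hD (σ := fun i z => Fin.init (Fin.init z : Fin (n + 1) → ℕ) i) (fun i => .proj _)
        (.proj _) (hc.beta (.proj _)))
  have hfind : ByProg fun x => Nat.find (hex x) :=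
    ByProgPred.find hP (fun x => Nat.find_spec (hex x)) fun x z hz => Nat.find_min (hex x) hz
  exact (hfind.beta hN).of_eq fun x => hspec x _ (Nat.find_spec (hex x)) _ le_rfl

theorem of_primrec' {f : List.Vector ℕ n → ℕ} (hf : Nat.Primrec' f) :
    ByProg fun x => f (List.Vector.ofFn x) := by
  induction hf with
  | zero => exact .const 0
  | succ => exact (ByProg.proj 0).succ
  | get i => exact (ByProg.proj i).of_eq fun x => (List.Vector.get_ofFn x i).symm
  | comp g _ _ ihf ihg => exact ihf.comp ihg
  | @prec k f g _ _ ihf ihg =>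
    refine (prec (B := fun x => f (List.Vector.ofFn fun i => x i.succ))
      (D := fun x i r => g (i ::ᵥ r ::ᵥ List.Vector.ofFn fun i => x i.succ)) (N := fun x => x 0)
      (ihf.comp fun i => .proj i.succ) (.proj 0) fun {l σ I J} hσ hI hJ => ?_).of_eq fun x => ?_
    · refine (ihg.comp (D := Fin.cons I (Fin.cons J fun i => σ i.succ)) fun i => ?_).of_eq
        fun x => rfl
      refine Fin.cases hI (fun i => ?_) i
      refine Fin.cases hJ (fun i => ?_) i
      exact hσ i.succ
    · simp only [List.Vector.ofFn, List.Vector.head_cons, List.Vector.tail_cons]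

end ByProg

end TotalFunctions

/-! ### A program with undecidable halting -/

section Halting

/-- Minimization over the bound of the universal evaluator `evaln` halts on a code exactly when that
code halts on input `0`, so a decision procedure would solve the halting problem for
`Nat.Partrec.Code`. -/
theorem exists_undecidable_prog :
    ∃ f : Prog 1, ¬ ComputablePred fun k : ℕ => f.Terminates fun _ => k := by
  -- `none` is encoded by `0` and `some y` by `y + 1`, so `t` is `0` if the code `v.head` returns a
  -- value within the bound `v.tail.head`, and `1` otherwise.
  let t (v : List.Vector ℕ 2) : ℕ := 1 - (Encodable.encode
    (Nat.Partrec.Code.evaln v.tail.head (Denumerable.ofNat Nat.Partrec.Code v.head) 0))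
  have ht : Primrec t := by
    refine Primrec.nat_sub.comp (.const 1) (Primrec.encode.comp
      (Nat.Partrec.Code.primrec_evaln.comp (.pair (.pair ?_ ?_) (.const 0))))
    · exact Primrec.vector_head.comp Primrec.vector_tail
    · exact (Primrec.ofNat _).comp Primrec.vector_head
  obtain ⟨f, hf⟩ := ByProg.of_primrec' (Nat.Primrec'.of_prim ht)
  refine ⟨.mu f, fun h => ComputablePred.halting_problem 0 ?_⟩
  have hterm (c : Nat.Partrec.Code) :
      (c.eval 0).Dom ↔ (Prog.mu f).Terminates fun _ => Encodable.encode c := by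
    have htm (k : ℕ) : f.eval (Fin.snoc (fun _ : Fin 1 => Encodable.encode c) k : Fin 2 → ℕ) =
        Part.some (1 - Encodable.encode (Nat.Partrec.Code.evaln k c 0)) := by
      rw [hf]
      simp only [t, List.Vector.ofFn, List.Vector.head_cons, List.Vector.tail_cons]
      simp [Fin.snoc]
    unfold Prog.Terminates
    rw [Part.dom_iff_mem, Part.dom_iff_mem]
    constructor
    · rintro ⟨y, hy⟩
      obtain ⟨k, hk⟩ := Nat.Partrec.Code.evaln_complete.1 hy
      have hex : ∃ k, (1 - Encodable.encode (Nat.Partrec.Code.evaln k c 0)) = 0 :=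
        ⟨k, by rw [Option.mem_def.1 hk]; simp⟩
      classical
      refine ⟨Nat.find hex, (Prog.mem_eval_mu _ _ _).2 ⟨?_, fun z hz => ⟨0, ?_⟩⟩⟩
      · rw [htm, Nat.find_spec hex]
        exact Part.mem_some _
      · have := Nat.find_min hex hz
        rw [htm, Part.mem_some_iff]
        omega
    · rintro ⟨k, hk⟩
      have h0 := ((Prog.mem_eval_mu _ _ _).1 hk).1
      rw [htm, Part.mem_some_iff] at h0
      cases he : Nat.Partrec.Code.evaln k c 0 with
      | none => simp [he] at h0
      | some y => exact ⟨y, Nat.Partrec.Code.evaln_sound he⟩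
  exact ComputablePred.computable_of_manyOneReducible ⟨_, Computable.encode, hterm⟩ h

end Halting

/-! ### Decoding trees -/

section Trees

/-- The label and the numbers of the immediate subtrees of the tree with number `c`. -/
def parts (c : ℕ) : List ℕ := Denumerable.ofNat (List ℕ) c

/-- The `i`-th entry of `parts c`. -/
def part (c i : ℕ) : ℕ := (parts c).getD i 0

@[simp]
theorem parts_tree (l : ℕ) (ts : List ℕ) : parts (tree l ts) = l :: ts :=
  Denumerable.ofNat_encode _

theorem encode_parts (c : ℕ) : Encodable.encode (parts c) = c := Denumerable.encode_ofNat c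

theorem eq_tree_of_parts {c l : ℕ} {ts : List ℕ} (h : parts c = l :: ts) : c = tree l ts := by
  rw [tree, ← h, encode_parts]

theorem tree_inj {l l' : ℕ} {ts ts' : List ℕ} : tree l ts = tree l' ts' ↔ l = l' ∧ ts = ts' := by
  rw [tree, tree, Encodable.encode_inj, List.cons.injEq]

theorem tree_pos (l : ℕ) (ts : List ℕ) : 0 < tree l ts := by
  rw [tree, Encodable.encode_list_cons]
  exact Nat.succ_pos _

theorem lt_encode_of_mem {a : ℕ} {ts : List ℕ} (h : a ∈ ts) : a < Encodable.encode ts := by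
  induction ts with
  | nil => simp at h
  | cons b ts ih =>
    rw [Encodable.encode_list_cons, Nat.lt_succ_iff]
    rcases List.mem_cons.1 h with rfl | h
    · exact Nat.left_le_pair _ _
    · exact (ih h).le.trans (Nat.right_le_pair _ _)

theorem lt_of_mem_parts {a c : ℕ} (h : a ∈ parts c) : a < c := by
  conv_rhs => rw [← encode_parts c]
  exact lt_encode_of_mem h

/-- Entries are smaller than the code of their list, and entries out of range default to `0`, whence
`0 < c`. The recursions on numbers below terminate for this reason. -/
theorem part_lt {c : ℕ} (hc : 0 < c) (i : ℕ) : part c i < c := by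
  rcases lt_or_ge i (parts c).length with h | h
  · rw [part, List.getD_eq_getElem _ _ h]
    exact lt_of_mem_parts (List.getElem_mem h)
  · rwa [part, List.getD_eq_default _ _ h]

theorem pos_of_part_ne {c i : ℕ} (h : part c i ≠ 0) : 0 < c := by
  rcases Nat.eq_zero_or_pos c with rfl | h0
  · simp [part, parts] at h
  · exact h0

theorem primrec_parts : Primrec parts := Primrec.ofNat _

theorem primrec_part : Primrec₂ part :=
  (Primrec.list_getD 0).comp (primrec_parts.comp .fst) .snd

variable {α : Type*} [Primcodable α]

theorem primrec_tree {f : α → ℕ} {g : α → List ℕ} (hf : Primrec f) (hg : Primrec g) :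
    Primrec fun a => tree (f a) (g a) := Primrec.encode.comp (Primrec.list_cons.comp hf hg)

theorem primrec_tree₁ (l : ℕ) {f : α → ℕ} (hf : Primrec f) : Primrec fun a => tree l [f a] :=
  primrec_tree (.const l) (Primrec.list_cons.comp hf (.const []))

theorem primrec_tree₂ (l : ℕ) {f g : α → ℕ} (hf : Primrec f) (hg : Primrec g) :
    Primrec fun a => tree l [f a, g a] :=
  primrec_tree (.const l) (Primrec.list_cons.comp hf (Primrec.list_cons.comp hg (.const [])))

end Trees

/-! ### Recognizing the numbers of programs -/

section Arity

/-- The numbers of the programs from which the program with number `c` is built. -/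
def subprograms (c : ℕ) : List ℕ :=
  if part c 0 = 6 then (parts c).drop 2 else if part c 0 = 7 then [part c 2] else []

theorem lt_of_mem_subprograms {a c : ℕ} (h : a ∈ subprograms c) : a < c := by
  unfold subprograms at h
  split_ifs at h with h₁ h₂
  · exact lt_of_mem_parts (List.mem_of_mem_drop h)
  · rw [List.mem_singleton.1 h]
    exact part_lt (pos_of_part_ne (i := 0) (by omega)) _
  · simp at h

/-- The arity of the program with number `c`, if there is one, from those of its subprograms. -/
def arityStep (c : ℕ) (rs : List (Option ℕ)) : Option ℕ :=
  -- Comparing the whole list also checks its length, so malformed trees are rejected.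
  if parts c = [0, part c 1, part c 2] ∧ part c 2 < part c 1 then some (part c 1)
  else if parts c = [1, part c 1] then some (part c 1)
  else if parts c = [2] then some 1
  else if parts c = [3] ∨ parts c = [4] ∨ parts c = [5] then some 2
  -- Label, arity and outer program take three entries; the rest are the inner programs. With fewer
  -- than three entries `subprograms c` is empty, so the test on `rs` fails.
  else if part c 0 = 6 ∧ rs = some ((parts c).length - 3) ::
    (List.range ((parts c).length - 3)).map fun _ => some (part c 1) then some (part c 1)
  else if parts c = [7, part c 1, part c 2] ∧ rs = [some (part c 1 + 1)] then some (part c 1)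
  else none

/-- The arity of the program with number `c`, if there is one. -/
def arity (c : ℕ) : Option ℕ :=
  arityStep c ((subprograms c).attach.map fun a => arity a.1)
termination_by c
decreasing_by exact lt_of_mem_subprograms a.2

theorem arity_eq (c : ℕ) : arity c = arityStep c ((subprograms c).map arity) := by
  rw [arity, List.attach_map_val (f := arity)]

/-- Course-of-values recursion: the calls go to smaller numbers, listed by the primitive recursive
`subprograms`. -/
theorem primrec_arity : Primrec arity := by
  have h1 : Primrec fun a : ℕ × List (Option ℕ) => part a.1 1 :=
    primrec_part.comp .fst (.const 1)
  have h2 : Primrec fun a : ℕ × List (Option ℕ) => part a.1 2 :=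
    primrec_part.comp .fst (.const 2)
  have hp : Primrec fun a : ℕ × List (Option ℕ) => parts a.1 := primrec_parts.comp .fst
  have hl : Primrec fun a : ℕ × List (Option ℕ) => (parts a.1).length - 3 :=
    Primrec.nat_sub.comp (Primrec.list_length.comp hp) (.const 3)
  have hs (l : ℕ) : PrimrecPred fun a : ℕ × List (Option ℕ) => parts a.1 = [l] :=
    Primrec.eq.comp hp (.const [l])
  refine Primrec.nat_omega_rec' (m := id) (l := subprograms) (g := fun c rs => some (arityStep c rs))
    _ .id ?_ (Primrec.option_some.comp ?_) (fun _ _ => lt_of_mem_subprograms)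
    fun c => congrArg some (arity_eq c).symm
  · exact Primrec.ite (Primrec.eq.comp (primrec_part.comp .id (.const 0)) (.const 6))
      (Primrec.list_drop.comp (.const 2) primrec_parts)
      (Primrec.ite (Primrec.eq.comp (primrec_part.comp .id (.const 0)) (.const 7))
        (Primrec.list_cons.comp (primrec_part.comp .id (.const 2)) (.const [])) (.const []))
  · refine Primrec.ite (.and (Primrec.eq.comp hp ?_) (Primrec.nat_lt.comp h2 h1))
      (Primrec.option_some.comp h1) ?_
    · exact Primrec.list_cons.comp (.const 0)
        (Primrec.list_cons.comp h1 (Primrec.list_cons.comp h2 (.const [])))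
    refine Primrec.ite (Primrec.eq.comp hp (Primrec.list_cons.comp (.const 1)
        (Primrec.list_cons.comp h1 (.const [])))) (Primrec.option_some.comp h1) ?_
    refine Primrec.ite (hs 2) (.const _) ?_
    refine Primrec.ite (.or (hs 3) (.or (hs 4) (hs 5))) (.const _) ?_
    refine Primrec.ite (.and (Primrec.eq.comp (primrec_part.comp .fst (.const 0)) (.const 6))
      (Primrec.eq.comp .snd (Primrec.list_cons.comp (Primrec.option_some.comp hl) ?_)))
        (Primrec.option_some.comp h1) ?_
    · exact Primrec.list_map (Primrec.list_range.comp hl) (Primrec.option_some.comp (h1.comp .fst))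
    refine Primrec.ite (.and (Primrec.eq.comp hp ?_) (Primrec.eq.comp .snd
      (Primrec.list_cons.comp (Primrec.option_some.comp (Primrec.succ.comp h1)) (.const []))))
        (Primrec.option_some.comp h1) (.const _)
    exact Primrec.list_cons.comp (.const 7)
      (Primrec.list_cons.comp h1 (Primrec.list_cons.comp h2 (.const [])))

theorem arity_code {n : ℕ} (f : Prog n) : arity f.code = some n := by
  induction f with
  | proj i => simp [arity_eq, arityStep, Prog.code, part]
  | zero k => simp [arity_eq, arityStep, Prog.code, part]
  | succ => simp [arity_eq, arityStep, Prog.code, part]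
  | add => simp [arity_eq, arityStep, Prog.code, part]
  | mul => simp [arity_eq, arityStep, Prog.code, part]
  | leq => simp [arity_eq, arityStep, Prog.code, part]
  | comp h g ihh ihg =>
    simp [arity_eq (tree _ _), arityStep, Prog.code, part, subprograms, ihh, ihg,
      List.map_ofFn, Function.comp_def]
  | mu g ih => simp [arity_eq (tree _ _), arityStep, Prog.code, part, subprograms, ih]

/-- Each test in `arityStep` leaves enough data to rebuild a program. With `arity_code`, this makes
`arity` an exact test for numbers of programs. -/
theorem exists_code_of_arity {c n : ℕ} (h : arity c = some n) : ∃ f : Prog n, f.code = c := by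
  induction c using Nat.strong_induction_on generalizing n with
  | _ c ih =>
    rw [arity_eq, arityStep] at h
    split_ifs at h with h0 h1 h2 h3 h6 h7 <;> obtain rfl := Option.some.inj h
    · exact ⟨.proj ⟨part c 2, h0.2⟩, (eq_tree_of_parts h0.1).symm⟩
    · exact ⟨.zero _, (eq_tree_of_parts h1).symm⟩
    · exact ⟨.succ, (eq_tree_of_parts h2).symm⟩
    · rcases h3 with h3 | h3 | h3
      · exact ⟨.add, (eq_tree_of_parts h3).symm⟩
      · exact ⟨.mul, (eq_tree_of_parts h3).symm⟩
      · exact ⟨.leq, (eq_tree_of_parts h3).symm⟩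
    · obtain ⟨h6, hs⟩ := h6
      rw [subprograms, if_pos h6] at hs
      rcases hp : parts c with _ | ⟨l, _ | ⟨a, _ | ⟨b, gs⟩⟩⟩
      · simp [hp] at hs
      · simp [hp] at hs
      · simp [hp] at hs
      · have hl : l = 6 := by simpa [part, hp] using h6
        subst hl
        have ha : part c 1 = a := by simp [part, hp]
        rw [ha]
        simp only [hp, ha, List.drop_succ_cons, List.drop_zero, List.map_cons, List.cons.injEq,
          List.length_cons] at hs
        obtain ⟨f, hf⟩ := ih b (lt_of_mem_parts (by simp [hp])) hs.1
        have hg (i : Fin gs.length) : ∃ g : Prog a, g.code = gs.get i := by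
          refine ih _ (lt_of_mem_parts (by simp [hp])) ?_
          have : arity (gs.get i) ∈ gs.map arity := List.mem_map_of_mem (List.get_mem _ _)
          rw [hs.2] at this
          obtain ⟨_, _, h⟩ := List.mem_map.1 this
          exact h.symm
        choose g hg using hg
        refine ⟨.comp f g, ?_⟩
        rw [eq_tree_of_parts hp, Prog.code, hf]
        simp only [hg]
        exact congrArg (fun l => tree 6 (a :: b :: l)) (List.ofFn_get gs)
    · obtain ⟨h7, hs⟩ := h7
      have hl : part c 0 = 7 := by
        rw [part, h7]
        rfl
      rw [subprograms, if_neg (by omega), if_pos hl, List.map_singleton, List.singleton_inj] at hs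
      obtain ⟨f, hf⟩ := ih _ (part_lt (pos_of_part_ne (i := 0) (by omega)) _) hs
      exact ⟨.mu f, by rw [Prog.code, hf, ← eq_tree_of_parts h7]⟩

end Arity

/-! ### Injectivity of the numbering -/

section CodeInjective

variable {L : FirstOrder.Language.{u, v}} (num : SymbolNumbering L)

theorem SymbolNumbering.termCode_injective {n : ℕ} :
    Function.Injective (num.termCode : Tm L n → ℕ) := by
  intro t
  induction t using Tm.ind with
  | hv i =>
    intro s h
    induction s using Tm.ind with
    | hv j =>
      simp only [bv, SymbolNumbering.termCode, tree_inj, List.cons.injEq, and_true, true_and] at h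
      rw [Fin.ext h]
    | hf l f ts => simp [bv, SymbolNumbering.termCode, tree_inj] at h
  | hf l f ts ih =>
    intro s h
    induction s using Tm.ind with
    | hv j => simp [bv, SymbolNumbering.termCode, tree_inj] at h
    | hf l' f' ts' =>
      simp only [SymbolNumbering.termCode, tree_inj, Nat.add_right_cancel_iff] at h
      obtain ⟨hf, hts⟩ := h
      obtain ⟨rfl, hf⟩ := Sigma.mk.inj (num.func_injective hf)
      obtain rfl := eq_of_heq hf
      congr 1
      funext i
      exact ih i (congrFun (List.ofFn_injective hts) i)

/-- A tree number determines label and subtrees, and the shift by `4` keeps relation symbols apart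
from the logical labels. -/
theorem SymbolNumbering.code_injective {n : ℕ} : Function.Injective (num.code : Fm L n → ℕ) := by
  intro A
  induction A with
  | falsum =>
    intro B h
    cases B with
    | falsum => rfl
    | _ => simp [SymbolNumbering.code, tree_inj] at h
  | equal s t =>
    intro B h
    cases B with
    | equal s' t' =>
      simp only [SymbolNumbering.code, tree_inj, List.cons.injEq, and_true, true_and] at h
      rw [num.termCode_injective h.1, num.termCode_injective h.2]
    | _ => simp [SymbolNumbering.code, tree_inj] at h; try omega
  | rel R ts =>
    intro B h
    cases B with
    | rel R' ts' =>
      simp only [SymbolNumbering.code, tree_inj, Nat.add_right_cancel_iff] at h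
      obtain ⟨hR, hts⟩ := h
      obtain ⟨rfl, hR⟩ := Sigma.mk.inj (num.rel_injective hR)
      obtain rfl := eq_of_heq hR
      congr 1
      funext i
      exact num.termCode_injective (congrFun (List.ofFn_injective hts) i)
    | _ => simp [SymbolNumbering.code, tree_inj] at h; try omega
  | imp A B ihA ihB =>
    intro C h
    cases C with
    | imp A' B' =>
      simp only [SymbolNumbering.code, tree_inj, List.cons.injEq, and_true, true_and] at h
      rw [ihA h.1, ihB h.2]
    | _ => simp [SymbolNumbering.code, tree_inj] at h; try omega
  | all A ih =>
    intro C h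
    cases C with
    | all A' =>
      simp only [SymbolNumbering.code, tree_inj, List.cons.injEq, and_true, true_and] at h
      rw [ih h]
    | _ => simp [SymbolNumbering.code, tree_inj] at h; try omega

end CodeInjective

section Codes

/-! The functions on numbers that correspond to the constructions of terms and propositions. -/

variable {L' : FirstOrder.Language.{u, v}} (num : SymbolNumbering (LA L'))

/-- The number of the variable `&i`. -/
def varC (i : ℕ) : ℕ := tree 0 [i]

/-- The number of the symbol `0`, `S`, `+` or `×`. -/
def symC {l : ℕ} (f : Func l) : ℕ := num.func ⟨l, Sum.inl f⟩ + 1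

/-- The number of `0`. -/
def zeroC : ℕ := tree (symC num .zero) []

/-- The number of `S(t)`, for `t` numbered `a`. -/
def succC (a : ℕ) : ℕ := tree (symC num .succ) [a]

/-- The number of `s + t`, for `s`, `t` numbered `a`, `b`. -/
def addC (a b : ℕ) : ℕ := tree (symC num .add) [a, b]

/-- The number of `s × t`, for `s`, `t` numbered `a`, `b`. -/
def mulC (a b : ℕ) : ℕ := tree (symC num .mul) [a, b]

/-- The number of the numeral of `p`. -/
def numeralC (p : ℕ) : ℕ := p.rec (zeroC num) fun _ => succC num

/-- The number of `s = t`, for `s`, `t` numbered `a`, `b`. -/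
def eqC (a b : ℕ) : ℕ := tree 1 [a, b]

/-- The number of `¬ A`, for `A` numbered `a`. -/
def notC (a : ℕ) : ℕ := tree 2 [a, tree 0 [] ]

/-- The number of `∃ A`, for `A` numbered `a`. -/
def exC (a : ℕ) : ℕ := notC (tree 3 [notC a])

/-- The number of `A ∧ B`, for `A`, `B` numbered `a`, `b`. -/
def andC (a b : ℕ) : ℕ := notC (tree 2 [a, notC b])

/-- The number of `A ∨ B`, for `A`, `B` numbered `a`, `b`. -/
def orC (a b : ℕ) : ℕ := tree 2 [notC a, b]

/-- The number of `s ≤ t`, for `s`, `t` in `k` variables numbered `a`, `b`. -/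
def leC (k a b : ℕ) : ℕ := exC (eqC (addC num (varC k) a) b)

/-- The number of `s < t`, for `s`, `t` in `k` variables numbered `a`, `b`. -/
def ltC (k a b : ℕ) : ℕ := leC num k (succC num a) b

variable {n : ℕ}

theorem termCode_bv (i : Fin n) : num.termCode (bv i) = varC i := rfl

theorem termCode_tZero : num.termCode (tZero : Tm (LA L') n) = zeroC num := rfl

theorem termCode_tSucc (t : Tm (LA L') n) :
    num.termCode (tSucc t) = succC num (num.termCode t) := rfl

theorem termCode_tAdd (s t : Tm (LA L') n) :
    num.termCode (tAdd s t) = addC num (num.termCode s) (num.termCode t) := rfl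

theorem termCode_tMul (s t : Tm (LA L') n) :
    num.termCode (tMul s t) = mulC num (num.termCode s) (num.termCode t) := rfl

theorem termCode_numeral (p : ℕ) : num.termCode (numeral p : Tm (LA L') n) = numeralC num p := by
  induction p with
  | zero => rfl
  | succ p ih => rw [numeral, termCode_tSucc, ih]; rfl

/-- Variables are numbered by level, counted from the outside, so weakening leaves numbers unchanged
and terms pass under quantifiers without recoding. -/
theorem termCode_substT {m : ℕ} (σ : Fin n → Fin m) (hσ : ∀ i, (σ i : ℕ) = i)
    (t : Tm (LA L') n) : num.termCode (substT (fun i => bv (σ i)) t) = num.termCode t := by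
  induction t using Tm.ind with
  | hv i => rw [substT_bv_apply, termCode_bv, termCode_bv, hσ]
  | hf l f ts ih => simp only [substT_func, SymbolNumbering.termCode, ih]

theorem termCode_wkT (t : Tm (LA L') n) : num.termCode (wkT t) = num.termCode t :=
  termCode_substT num Fin.castSucc (fun _ => rfl) t

theorem termCode_wkTN (m : ℕ) (t : Tm (LA L') n) : num.termCode (wkTN m t) = num.termCode t :=
  termCode_substT num (Fin.castAdd m) (fun _ => rfl) t

theorem code_fEq (s t : Tm (LA L') n) :
    num.code (fEq s t) = eqC (num.termCode s) (num.termCode t) := rfl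

theorem code_ex (A : Fm (LA L') (n + 1)) : num.code A.ex = exC (num.code A) := rfl

theorem code_all (A : Fm (LA L') (n + 1)) : num.code A.all = tree 3 [num.code A] := rfl

theorem code_imp (A B : Fm (LA L') n) : num.code (A.imp B) = tree 2 [num.code A, num.code B] := rfl

theorem code_inf (A B : Fm (LA L') n) : num.code (A ⊓ B) = andC (num.code A) (num.code B) := rfl

theorem code_sup (A B : Fm (LA L') n) : num.code (A ⊔ B) = orC (num.code A) (num.code B) := rfl

theorem code_fLe (s t : Tm (LA L') n) :
    num.code (fLe s t) = leC num n (num.termCode s) (num.termCode t) := by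
  rw [fLe, code_ex, code_fEq, termCode_tAdd, termCode_wkT, termCode_wkT]
  rfl

theorem code_fLt (s t : Tm (LA L') n) :
    num.code (fLt s t) = ltC num n (num.termCode s) (num.termCode t) := code_fLe num _ _

theorem code_exN (m : ℕ) (A : Fm (LA L') (n + m)) : num.code (exN m A) = exC^[m] (num.code A) := by
  induction m with
  | zero => rfl
  | succ m ih => exact ih (BoundedFormula.ex (n := n + m) A)

theorem code_conjN {m : ℕ} (B : Fin m → Fm (LA L') n) (C : Fm (LA L') n) :
    num.code (conjN B C) = (List.ofFn fun i => num.code (B i)).foldr andC (num.code C) := by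
  have : (List.ofFn fun i => num.code (B i)) = (List.ofFn B).map num.code := by
    rw [List.map_ofFn]
    rfl
  rw [this, conjN]
  induction List.ofFn B with
  | nil => rfl
  | cons D l ih => rw [List.foldr_cons, code_inf, ih]; rfl

variable {α : Type*} [Primcodable α] {f g h : α → ℕ}

theorem primrec_varC (hf : Primrec f) : Primrec fun a => varC (f a) := primrec_tree₁ _ hf

theorem primrec_succC (hf : Primrec f) : Primrec fun a => succC num (f a) := primrec_tree₁ _ hf

theorem primrec_addC (hf : Primrec f) (hg : Primrec g) : Primrec fun a => addC num (f a) (g a) :=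
  primrec_tree₂ _ hf hg

theorem primrec_mulC (hf : Primrec f) (hg : Primrec g) : Primrec fun a => mulC num (f a) (g a) :=
  primrec_tree₂ _ hf hg

theorem primrec_numeralC : Primrec (numeralC num) :=
  Primrec.nat_rec₁ _ (primrec_succC num .snd)

theorem primrec_eqC (hf : Primrec f) (hg : Primrec g) : Primrec fun a => eqC (f a) (g a) :=
  primrec_tree₂ _ hf hg

theorem primrec_notC (hf : Primrec f) : Primrec fun a => notC (f a) :=
  primrec_tree₂ _ hf (.const _)

theorem primrec_exC (hf : Primrec f) : Primrec fun a => exC (f a) :=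
  primrec_notC (primrec_tree₁ _ (primrec_notC hf))

theorem primrec_exC_iterate (hf : Primrec f) (hg : Primrec g) :
    Primrec fun a => exC^[f a] (g a) :=
  Primrec.nat_iterate (h := fun _ => exC) hf hg (primrec_exC .snd)

theorem primrec_andC (hf : Primrec f) (hg : Primrec g) : Primrec fun a => andC (f a) (g a) :=
  primrec_notC (primrec_tree₂ _ hf (primrec_notC hg))

theorem primrec_foldr_andC {l : α → List ℕ} (hl : Primrec l) (hf : Primrec f) :
    Primrec fun a => (l a).foldr andC (f a) :=
  Primrec.list_foldr (h := fun _ p => andC p.1 p.2) hl hf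
    (primrec_andC (Primrec.fst.comp .snd) (Primrec.snd.comp .snd))

theorem primrec_orC (hf : Primrec f) (hg : Primrec g) : Primrec fun a => orC (f a) (g a) :=
  primrec_tree₂ _ (primrec_notC hf) hg

theorem primrec_leC (hf : Primrec f) (hg : Primrec g) (hh : Primrec h) :
    Primrec fun a => leC num (f a) (g a) (h a) :=
  primrec_exC (primrec_eqC (primrec_addC num (primrec_varC hf) hg) hh)

theorem primrec_ltC (hf : Primrec f) (hg : Primrec g) (hh : Primrec h) :
    Primrec fun a => ltC num (f a) (g a) (h a) := primrec_leC num hf (primrec_succC num hg) hh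

end Codes

/-! ### Computing the number of a representing proposition -/

section RepresentationCode

variable {L' : FirstOrder.Language.{u, v}} (num : SymbolNumbering (LA L'))

/-- The data that determine the number of a proposition `A[t₁, …, tₙ, u]` representing a program:
the number of the program, the number of variables, the numbers of `t₁, …, tₙ`, and that of `u`. -/
abbrev ReprData : Type := ℕ × ℕ × List ℕ × ℕ

/-- The representing propositions from which a representing proposition is built. -/
def subRepr (b : ReprData) : List ReprData :=
  if part b.1 0 = 6 then
    -- The outer program comes first, applied to the new variables `w₁, …, wₘ`; `reprStep` finds its
    -- number at the head of `rs`.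
    (part b.1 2, b.2.1 + ((parts b.1).length - 3),
      (List.range ((parts b.1).length - 3)).map fun i => varC (b.2.1 + i), b.2.2.2) ::
    (List.range ((parts b.1).length - 3)).map fun i =>
      (part b.1 (3 + i), b.2.1 + ((parts b.1).length - 3), b.2.2.1, varC (b.2.1 + i))
  else if part b.1 0 = 7 then
    -- The same subprogram occurs twice: under the quantifiers for `z` and `w`, and at the result
    -- with value `0`.
    [(part b.1 2, b.2.1 + 2, b.2.2.1 ++ [varC b.2.1], succC num (varC (b.2.1 + 1))),
      (part b.1 2, b.2.1, b.2.2.1 ++ [b.2.2.2], zeroC num)]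
  else []

theorem lt_of_mem_subRepr {a b : ReprData} (h : a ∈ subRepr num b) : a.1 < b.1 := by
  unfold subRepr at h
  split_ifs at h with h₁ h₂
  · have hb : 0 < b.1 := pos_of_part_ne (i := 0) (by omega)
    rcases List.mem_cons.1 h with rfl | h
    · exact part_lt hb _
    · obtain ⟨i, _, rfl⟩ := List.mem_map.1 h
      exact part_lt hb _
  · have hb : 0 < b.1 := pos_of_part_ne (i := 0) (by omega)
    simp only [List.mem_cons, List.not_mem_nil, or_false] at h
    rcases h with rfl | rfl <;> exact part_lt hb _
  · simp at h

/-- The number of a representing proposition, from those of the propositions from which it is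
built. -/
def reprStep (b : ReprData) (rs : List ℕ) : ℕ :=
  if part b.1 0 = 0 then eqC b.2.2.2 (b.2.2.1.getD (part b.1 2) 0)
  else if part b.1 0 = 1 then eqC b.2.2.2 (zeroC num)
  else if part b.1 0 = 2 then eqC b.2.2.2 (succC num (b.2.2.1.getD 0 0))
  else if part b.1 0 = 3 then eqC b.2.2.2 (addC num (b.2.2.1.getD 0 0) (b.2.2.1.getD 1 0))
  else if part b.1 0 = 4 then eqC b.2.2.2 (mulC num (b.2.2.1.getD 0 0) (b.2.2.1.getD 1 0))
  else if part b.1 0 = 5 then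
    orC (andC (leC num b.2.1 (b.2.2.1.getD 0 0) (b.2.2.1.getD 1 0))
        (eqC b.2.2.2 (succC num (zeroC num))))
      (andC (ltC num b.2.1 (b.2.2.1.getD 1 0) (b.2.2.1.getD 0 0)) (eqC b.2.2.2 (zeroC num)))
  else if part b.1 0 = 6 then exC^[(parts b.1).length - 3] (rs.tail.foldr andC rs.headI)
  -- Labels above `7` also land here; their value is irrelevant, since `haltCode` tests `arity`
  -- first.
  else andC (tree 3 [tree 2 [ltC num (b.2.1 + 1) (varC b.2.1) b.2.2.2, exC (rs.getD 0 0)] ])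
    (rs.getD 1 0)

/-- The number of a representing proposition. -/
def reprCode (b : ReprData) : ℕ :=
  reprStep num b ((subRepr num b).attach.map fun a => reprCode a.1)
termination_by b.1
decreasing_by exact lt_of_mem_subRepr num a.2

theorem reprCode_eq (b : ReprData) :
    reprCode num b = reprStep num b ((subRepr num b).map (reprCode num)) := by
  rw [reprCode, List.attach_map_val (f := reprCode num)]

theorem primrec_subRepr : Primrec (subRepr num) := by
  have hp (i : ℕ) : Primrec fun b : ReprData => part b.1 i := primrec_part.comp .fst (.const i)
  have hk : Primrec fun b : ReprData => b.2.1 := Primrec.fst.comp .snd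
  have ht : Primrec fun b : ReprData => b.2.2.1 := Primrec.fst.comp (Primrec.snd.comp .snd)
  have hy : Primrec fun b : ReprData => b.2.2.2 := Primrec.snd.comp (Primrec.snd.comp .snd)
  have hl : Primrec fun b : ReprData => (parts b.1).length - 3 :=
    Primrec.nat_sub.comp (Primrec.list_length.comp (primrec_parts.comp .fst)) (.const 3)
  have hv : Primrec fun x : ReprData × ℕ => varC (x.1.2.1 + x.2) :=
    primrec_varC (Primrec.nat_add.comp (hk.comp .fst) .snd)
  have hkl : Primrec fun b : ReprData => b.2.1 + ((parts b.1).length - 3) :=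
    Primrec.nat_add.comp hk hl
  refine Primrec.ite (Primrec.eq.comp (hp 0) (.const 6)) ?_
    (Primrec.ite (Primrec.eq.comp (hp 0) (.const 7)) ?_ (.const []))
  · refine Primrec.list_cons.comp (.pair (hp 2) (.pair hkl (.pair ?_ hy))) ?_
    · exact Primrec.list_map (Primrec.list_range.comp hl) hv
    · refine Primrec.list_map (Primrec.list_range.comp hl)
        (Primrec.pair (β := ℕ) ?_ (Primrec.pair (hkl.comp .fst) (.pair (ht.comp .fst) hv)))
      exact primrec_part.comp (Primrec.fst.comp .fst) (Primrec.nat_add.comp (.const 3) .snd)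
  · refine Primrec.list_cons.comp (.pair (hp 2) (.pair (Primrec.nat_add.comp hk (.const 2))
      (.pair ?_ ?_))) (Primrec.list_cons.comp (.pair (hp 2) (.pair hk (.pair ?_ (.const _))))
        (.const []))
    · exact Primrec.list_append.comp ht (Primrec.list_cons.comp (primrec_varC hk) (.const []))
    · exact primrec_succC num (primrec_varC (Primrec.succ.comp hk))
    · exact Primrec.list_append.comp ht (Primrec.list_cons.comp hy (.const []))

theorem primrec_reprStep : Primrec₂ (reprStep num) := by
  have hp (i : ℕ) : Primrec fun x : ReprData × List ℕ => part x.1.1 i :=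
    primrec_part.comp (Primrec.fst.comp .fst) (.const i)
  have hk : Primrec fun x : ReprData × List ℕ => x.1.2.1 :=
    Primrec.fst.comp (Primrec.snd.comp .fst)
  have ht : Primrec fun x : ReprData × List ℕ => x.1.2.2.1 :=
    Primrec.fst.comp (Primrec.snd.comp (Primrec.snd.comp .fst))
  have hy : Primrec fun x : ReprData × List ℕ => x.1.2.2.2 :=
    Primrec.snd.comp (Primrec.snd.comp (Primrec.snd.comp .fst))
  have hti (i : ℕ) : Primrec fun x : ReprData × List ℕ => x.1.2.2.1.getD i 0 :=
    (Primrec.list_getD 0).comp ht (.const i)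
  have hri (i : ℕ) : Primrec fun x : ReprData × List ℕ => x.2.getD i 0 :=
    (Primrec.list_getD 0).comp .snd (.const i)
  have hc (l : ℕ) : PrimrecPred fun x : ReprData × List ℕ => part x.1.1 0 = l :=
    Primrec.eq.comp (hp 0) (.const l)
  refine Primrec.ite (hc 0) (primrec_eqC hy ((Primrec.list_getD 0).comp ht (hp 2))) ?_
  refine Primrec.ite (hc 1) (primrec_eqC hy (.const _)) ?_
  refine Primrec.ite (hc 2) (primrec_eqC hy (primrec_succC num (hti 0))) ?_
  refine Primrec.ite (hc 3) (primrec_eqC hy (primrec_addC num (hti 0) (hti 1))) ?_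
  refine Primrec.ite (hc 4) (primrec_eqC hy (primrec_mulC num (hti 0) (hti 1))) ?_
  refine Primrec.ite (hc 5) (primrec_orC
    (primrec_andC (primrec_leC num hk (hti 0) (hti 1)) (primrec_eqC hy (.const _)))
    (primrec_andC (primrec_ltC num hk (hti 1) (hti 0)) (primrec_eqC hy (.const _)))) ?_
  refine Primrec.ite (hc 6) ?_ ?_
  · refine primrec_exC_iterate (Primrec.nat_sub.comp (Primrec.list_length.comp
      (primrec_parts.comp (Primrec.fst.comp .fst))) (.const 3)) ?_
    exact primrec_foldr_andC (Primrec.list_tail.comp .snd) (Primrec.list_headI.comp .snd)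
  · refine primrec_andC (primrec_tree₁ _ (primrec_tree₂ _ ?_ (primrec_exC (hri 0)))) (hri 1)
    exact primrec_ltC num (Primrec.succ.comp hk) (primrec_varC hk) hy

/-- Terms and variable counts change from call to call, but the program number decreases and serves
as the measure. -/
theorem primrec_reprCode : Primrec (reprCode num) :=
  Primrec.nat_omega_rec' (m := Prod.fst) (g := fun b rs => some (reprStep num b rs)) _ .fst
    (primrec_subRepr num) (Primrec.option_some.comp (primrec_reprStep num))
    (fun _ _ => lt_of_mem_subRepr num) fun b => congrArg some (reprCode_eq num b).symm

theorem range_map_eq_ofFn {β : Type*} (m : ℕ) (f : ℕ → β) :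
    (List.range m).map f = List.ofFn fun i : Fin m => f i := by
  rw [List.ofFn_eq_map, ← List.map_coe_finRange_eq_range, List.map_map]
  rfl

theorem ofFn_snoc {β γ : Type*} {n : ℕ} (t : Fin n → β) (s : β) (c : β → γ) :
    (List.ofFn fun i => c ((Fin.snoc t s : Fin (n + 1) → β) i)) =
      (List.ofFn fun i => c (t i)) ++ [c s] := by
  rw [List.ofFn_succ', List.concat_eq_append]
  simp

theorem code_repr {a : ℕ} (f : Prog a) {k : ℕ} (t : Fin a → Tm (LA L') k) (y : Tm (LA L') k) :
    num.code (f.repr t y) =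
      reprCode num (f.code, k, List.ofFn fun i => num.termCode (t i), num.termCode y) := by
  rw [reprCode_eq]
  induction f generalizing k with
  | proj i =>
    simp [reprStep, Prog.code, part, Prog.repr, code_fEq]
  | zero m => simp [reprStep, Prog.code, part, Prog.repr, code_fEq, termCode_tZero]
  | succ => simp [reprStep, Prog.code, part, Prog.repr, code_fEq, termCode_tSucc]
  | add => simp [reprStep, Prog.code, part, Prog.repr, code_fEq, termCode_tAdd]
  | mul => simp [reprStep, Prog.code, part, Prog.repr, code_fEq, termCode_tMul]
  | leq =>
    simp [reprStep, Prog.code, part, Prog.repr, code_fEq, code_fLe, code_fLt, code_inf, code_sup,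
      termCode_tSucc, termCode_tZero]
  | comp h g ihh ihg =>
    simp only [← reprCode_eq] at ihh ihg
    simp [reprStep, subRepr, Prog.code, part, Prog.repr, code_exN, code_conjN, ihh, ihg,
      range_map_eq_ofFn, termCode_wkTN, termCode_bv, List.map_ofFn, Function.comp_def,
      Nat.add_comm 3]
  | mu g ih =>
    simp only [← reprCode_eq] at ih
    simp [-List.ofFn_succ, reprStep, subRepr, Prog.code, part, Prog.repr, code_inf, code_all,
      code_imp, code_ex, code_fLt, ih, ofFn_snoc, termCode_wkT, termCode_bv, termCode_tSucc, termCode_tZero]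

end RepresentationCode

/-! ### Reduction of halting to provability -/

section Reduction

variable {L' : FirstOrder.Language.{u, v}} (num : SymbolNumbering (LA L'))

/-- The reduction of the halting problem to provability: the number of an instance `f, p₁, …, pₙ`
is mapped to the number of `∃ y A[p₁, …, pₙ, y]`, where `A` represents `f`, and the numbers that
are not numbers of instances are mapped to the number of `⊥`. -/
def haltCode (k : ℕ) : ℕ :=
  -- `0` codes the empty list, hence no tree.
  if k ≠ 0 ∧ arity (part k 0) = some (parts k).tail.length then
    exC (reprCode num (part k 0, 1, (parts k).tail.map (numeralC num), varC 0))
  else tree 0 []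

theorem primrec_haltCode : Primrec (haltCode num) := by
  have h0 : Primrec fun k => part k 0 := primrec_part.comp .id (.const 0)
  have ht : Primrec fun k => (parts k).tail := Primrec.list_tail.comp primrec_parts
  refine Primrec.ite (.and (PrimrecPred.not (Primrec.eq.comp .id (.const 0)))
    (Primrec.eq.comp (primrec_arity.comp h0)
      (Primrec.option_some.comp (Primrec.list_length.comp ht)))) ?_ (.const _)
  refine primrec_exC ((primrec_reprCode num).comp (.pair h0 (.pair (.const 1) (.pair ?_
    (.const _)))))
  exact Primrec.list_map ht ((primrec_numeralC num).comp .snd)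

theorem haltCode_instanceCode {n : ℕ} (f : Prog n) (p : Fin n → ℕ) :
    haltCode num (f.instanceCode p) = num.code (f.haltSentence L' p) := by
  have h : f.instanceCode p ≠ 0 := (tree_pos _ _).ne'
  have hp : parts (f.instanceCode p) = f.code :: List.ofFn p := parts_tree _ _
  rw [haltCode, if_pos]
  · rw [Prog.haltSentence, code_ex, code_repr]
    simp [part, hp, termCode_numeral, termCode_bv, List.map_ofFn, Function.comp_def]
  · simp [h, part, hp, arity_code]

theorem haltCode_of_forall_ne {k : ℕ}
    (hk : ∀ (n : ℕ) (f : Prog n) (p : Fin n → ℕ), f.instanceCode p ≠ k) :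
    haltCode num k = num.code (BoundedFormula.falsum : (LA L').Sentence) := by
  refine if_neg fun ⟨h0, h⟩ => ?_
  cases hp : parts k with
  | nil => exact h0 (by rw [← encode_parts k, hp]; rfl)
  | cons c ps =>
    simp only [part, hp, List.getD_cons_zero, List.tail_cons] at h
    obtain ⟨f, hf⟩ := exists_code_of_arity h
    refine hk _ f ps.get ?_
    rw [eq_tree_of_parts hp, Prog.instanceCode, hf]
    exact congrArg (tree c) (List.ofFn_get ps)

theorem halting_iff_provableCode {T : (LA L').Theory} (hext : ExtendsRobinson T)
    (hstd : HasStandardModel T) (k : ℕ) : Halting k ↔ ProvableCode num T (haltCode num k) := by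
  constructor
  · rintro ⟨n, f, p, rfl, h⟩
    exact ⟨f.haltSentence L' p, (haltCode_instanceCode num f p).symm,
      (provable_haltSentence_iff hext hstd f p).2 h⟩
  · rintro ⟨φ, hφ, h⟩
    by_cases hk : ∃ (n : ℕ) (f : Prog n) (p : Fin n → ℕ), f.instanceCode p = k
    · obtain ⟨n, f, p, rfl⟩ := hk
      rw [haltCode_instanceCode] at hφ
      rw [num.code_injective hφ] at h
      exact ⟨n, f, p, rfl, (provable_haltSentence_iff hext hstd f p).1 h⟩
    · push Not at hk
      rw [haltCode_of_forall_ne num hk] at hφ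
      rw [num.code_injective hφ] at h
      exact absurd h (not_provable_falsum hstd)

/-- One fixed program with undecidable halting suffices: its instances are mapped to halting
sentences by a primitive recursive function of the input. -/
theorem not_computablePred_provableCode {T : (LA L').Theory} (hext : ExtendsRobinson T)
    (hstd : HasStandardModel T) : ¬ ComputablePred (ProvableCode num T) := by
  intro h
  obtain ⟨f, hf⟩ := exists_undecidable_prog
  refine hf (ComputablePred.computable_of_manyOneReducible
    ⟨fun k => haltCode num (f.instanceCode fun _ => k), ?_, fun k => ?_⟩ h)
  · exact ((primrec_haltCode num).comp (primrec_tree₁ f.code .id)).to_comp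
  · beta_reduce
    rw [haltCode_instanceCode, ← provable_haltSentence_iff hext hstd]
    refine ⟨fun h => ⟨_, rfl, h⟩, fun ⟨φ, hφ, h⟩ => ?_⟩
    rwa [← num.code_injective hφ]

end Reduction

end Arithmetic

theorem mainTheorem2 {L' : FirstOrder.Language.{u, v}} [Finite L'.Symbols]
    (num : Arithmetic.SymbolNumbering (Arithmetic.LA L')) (T : (Arithmetic.LA L').Theory)
    (hdec : Arithmetic.DecidableAxioms num T)
    (hext : Arithmetic.ExtendsRobinson T)
    (hstd : Arithmetic.HasStandardModel T) :
    (∀ (n : ℕ) (f : Arithmetic.Prog n) (p : Fin n → ℕ),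
      Arithmetic.Provable T (f.haltSentence L' p) ↔ f.Terminates p) ∧
    (∃ F : ℕ → ℕ, Computable F ∧
      (∀ (n : ℕ) (f : Arithmetic.Prog n) (p : Fin n → ℕ),
        F (f.instanceCode p) = num.code (f.haltSentence L' p)) ∧
      ∀ k : ℕ, Arithmetic.Halting k ↔ Arithmetic.ProvableCode num T (F k)) ∧
    ¬ ComputablePred (Arithmetic.ProvableCode num T) :=
  ⟨fun _ f p => Arithmetic.provable_haltSentence_iff hext hstd f p,
    ⟨Arithmetic.haltCode num, (Arithmetic.primrec_haltCode num).to_comp,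
      fun _ f p => Arithmetic.haltCode_instanceCode num f p,
      Arithmetic.halting_iff_provableCode num hext hstd⟩,
    Arithmetic.not_computablePred_provableCode num hext hstd⟩
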